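/- Consider the nonlinear semidefinite program: minimize $f(x)$ over $x\in\mathbb R^n$ subject to $h(x)=0$ and $G(x)\succeq 0$, where $f:\mathbb R^n\to\mathbb R$, $h:\mathbb R^n\to\mathbb R^p$ and $G:\mathbb R^n\to\mathbb S^m$ (the symmetric $m\times m$ matrices) are twice continuously differentiable. For $\mu\in\mathbb R^p$ and $\Omega\in\mathbb S^m_+$ put $L(x,\mu,\Omega)=f(x)-\langle h(x),\mu\rangle-\langle G(x),\Omega\rangle$ with $\langle A,B\rangle=\operatorname{tr}(A^\top B)$, and let $\sigma(x,\Omega)=\big[\,2\langle\Omega,\partial_iG(x)\,G(x)^\dagger\,\partial_jG(x)\rangle\,\big]_{i,j=1}^n$, where $\dagger$ denotes the Moore–Penrose pseudoinverse. Let $\bar x$ be feasible and $b=\dim\ker G(\bar x)$. Let $\mathcal U$ be an analytic map from a neighbourhood $\mathcal N$ of $G(\bar x)$ in $\mathbb S^m$ to $\mathbb R^{m\times b}$ such that the columns of $\mathcal U(G(\bar x))$ form an orthonormal basis of $\ker G(\bar x)$ and, for every $M\in\mathcal N$, the columns of $\mathcal U(M)$ form an orthonormal basis of the space spanned by the eigenvectors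 belonging to the $b$ smallest eigenvalues of $M$ (such a map always exists). For $x$ with $G(x)\in\mathcal N$ define the perturbed critical subspace $$S(x,\bar x)=\{d\in\mathbb R^n:\ \mathrm Dh(x)d=0,\ \ \mathcal U(G(x))^\top\,\mathrm DG(x)[d]\;\mathcal U(G(x))=0\}.$$ A sequence $(x^k,\mu^k,\Omega_k)\in\mathbb R^n\times\mathbb R^p\times\mathbb S^m_+$ is a *CAKKT sequence* for $\bar x$ if $x^k\to\bar x$, $\nabla_xL(x^k,\mu^k,\Omega_k)\to0$ and $\tfrac12\big(G(x^k)\Omega_k+\Omega_kG(x^k)\big)\to0$. It is an *AKKT sequence* for $\bar x$ if $x^k\to\bar x$, $\nabla_xL(x^k,\mu^k,\Omega_k)\to0$, and there are orthogonal matrices $U_k\to U$ and diagonalizations $G(\bar x)=U\operatorname{diag}(\lambda_1,\dots,\lambda_m)U^\top$ and $\Omega_k=U_k\operatorname{diag}(\omega_{k,1},\dots,\omega_{k,m})U_k^\top$ such that, for every $j$ with $\lambda_j>0$, $\omega_{k,j}=0$ for all sufficiently large $k$. The point $\bar x$ satisfies *CAKKT2* (respectively *AKKT2*) if it is feasible and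 there are a CAKKT (respectively AKKT) sequence $(x^k,\mu^k,\Omega_k)$ for $\bar x$ and numbers $\varepsilon_k>0$, $\varepsilon_k\to0$, such that for every map $\mathcal U$ as above there is $\bar n$ with $G(x^k)\in\mathcal N$ and $$d^\top\big(\nabla^2_{xx}L(x^k,\mu^k,\Omega_k)+\sigma(x^k,\Omega_k)\big)d\ \ge\ -\varepsilon_k\|d\|^2\qquad\text{for all }k\ge\bar n\text{ and all }d\in S(x^k,\bar x).$$ **Theorem.** If $\bar x$ is a local minimizer of the program, then, without any constraint qualification, $\bar x$ satisfies CAKKT2, and it also satisfies AKKT2. -/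

import Mathlib

open Filter Topology Set
open scoped Matrix

attribute [local instance] Matrix.frobeniusNormedAddCommGroup Matrix.frobeniusNormedSpace

noncomputable section

namespace NSDP

/-! ### Linear algebra -/

section LinearAlgebra

variable {m b : ℕ}

/-- The trace inner product `⟨A, B⟩ = tr (Aᵀ B)`. -/
def matInner (A B : Matrix (Fin m) (Fin m) ℝ) : ℝ := (Aᵀ * B).trace

/-- The Jordan product `A ⊚ B = (A B + B A) / 2`. -/
def jordan (A B : Matrix (Fin m) (Fin m) ℝ) : Matrix (Fin m) (Fin m) ℝ :=
  (1 / 2 : ℝ) • (A * B + B * A)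

/-- The four Penrose equations: `X` is the Moore-Penrose pseudoinverse of `A`. -/
structure IsPseudoinverse (A X : Matrix (Fin m) (Fin m) ℝ) : Prop where
  mul_mul_self : A * X * A = A
  self_mul_mul : X * A * X = X
  isSymm_mul : (A * X).IsSymm
  isSymm_mul' : (X * A).IsSymm

open Classical in
/-- The Moore-Penrose pseudoinverse `A†`. -/
def pinv (A : Matrix (Fin m) (Fin m) ℝ) : Matrix (Fin m) (Fin m) ℝ :=
  if hA : ∃ X, IsPseudoinverse A X then hA.choose else 0

theorem IsPseudoinverse.unique {A X Y : Matrix (Fin m) (Fin m) ℝ}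
    (hX : IsPseudoinverse A X) (hY : IsPseudoinverse A Y) : X = Y := by
  have e1 : A * X = A * Y := by
    calc A * X = (A * X)ᵀ := hX.isSymm_mul.symm
      _ = (A * Y * A * X)ᵀ := by rw [hY.mul_mul_self]
      _ = (A * X)ᵀ * (A * Y)ᵀ := by rw [Matrix.mul_assoc (A * Y), Matrix.transpose_mul]
      _ = A * X * (A * Y) := by rw [hX.isSymm_mul.eq, hY.isSymm_mul.eq]
      _ = A * X * A * Y := by simp only [Matrix.mul_assoc]
      _ = A * Y := by rw [hX.mul_mul_self]
  have e2 : X * A = Y * A := by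
    calc X * A = (X * A)ᵀ := hX.isSymm_mul'.symm
      _ = (X * (A * Y * A))ᵀ := by rw [hY.mul_mul_self]
      _ = (X * A * (Y * A))ᵀ := by simp only [Matrix.mul_assoc]
      _ = Y * A * (X * A) := by
          rw [Matrix.transpose_mul, hX.isSymm_mul'.eq, hY.isSymm_mul'.eq]
      _ = Y * (A * X * A) := by simp only [Matrix.mul_assoc]
      _ = Y * A := by rw [hX.mul_mul_self]
  calc X = X * A * X := hX.self_mul_mul.symm
    _ = Y * A * X := by rw [e2]
    _ = Y * (A * X) := Matrix.mul_assoc _ _ _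
    _ = Y * (A * Y) := by rw [e1]
    _ = Y * A * Y := (Matrix.mul_assoc _ _ _).symm
    _ = Y := hY.self_mul_mul

/-- A real symmetric matrix has an orthogonal diagonalization with non-increasing eigenvalues. -/
theorem exists_sorted_diagonalization {M : Matrix (Fin m) (Fin m) ℝ} (hM : M.IsSymm) :
    ∃ V ∈ Matrix.orthogonalGroup (Fin m) ℝ, ∃ lam : Fin m → ℝ, Antitone lam ∧
      M = V * Matrix.diagonal lam * Vᵀ := by
  have hH : M.IsHermitian := by
    rw [Matrix.IsHermitian, Matrix.conjTranspose_eq_transpose_of_trivial]; exact hM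
  set V₀ : Matrix (Fin m) (Fin m) ℝ := (hH.eigenvectorUnitary : Matrix (Fin m) (Fin m) ℝ)
  have hV₀ : V₀ * V₀ᵀ = 1 := by
    have := Matrix.mem_unitaryGroup_iff.mp hH.eigenvectorUnitary.2
    rwa [Matrix.star_eq_conjTranspose, Matrix.conjTranspose_eq_transpose_of_trivial] at this
  have hsp : M = V₀ * Matrix.diagonal hH.eigenvalues * V₀ᵀ := by
    have := hH.spectral_theorem
    rw [Unitary.conjStarAlgAut_apply, Matrix.star_eq_conjTranspose,
      Matrix.conjTranspose_eq_transpose_of_trivial] at this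
    simpa [Function.comp_def] using this
  let σ : Equiv.Perm (Fin m) := Tuple.sort (fun i => - hH.eigenvalues i)
  have hσ : Monotone ((fun i => - hH.eigenvalues i) ∘ σ) := Tuple.monotone_sort _
  refine ⟨V₀.submatrix id σ, ?_, hH.eigenvalues ∘ σ, ?_, ?_⟩
  · rw [Matrix.mem_orthogonalGroup_iff, Matrix.transpose_submatrix,
      Matrix.submatrix_mul_equiv, hV₀]
    rfl
  · intro i j hij
    have := hσ hij
    simp only [Function.comp] at this ⊢
    linarith
  · conv_lhs => rw [hsp]
    rw [show Matrix.diagonal (hH.eigenvalues ∘ σ) = (Matrix.diagonal hH.eigenvalues).submatrix σ σ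
      by rw [Matrix.submatrix_diagonal_equiv], Matrix.transpose_submatrix,
      Matrix.submatrix_mul_equiv, Matrix.submatrix_mul_equiv]
    rfl

/-- `V diag(λ⁻¹) Vᵀ` (with `0⁻¹ = 0`) is the pseudoinverse of `V diag(λ) Vᵀ`. -/
theorem isPseudoinverse_diagonalization {V : Matrix (Fin m) (Fin m) ℝ}
    (hV : V ∈ Matrix.orthogonalGroup (Fin m) ℝ) (lam : Fin m → ℝ) :
    IsPseudoinverse (V * Matrix.diagonal lam * Vᵀ)
      (V * Matrix.diagonal (fun i => (lam i)⁻¹) * Vᵀ) := by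
  have h1 : Vᵀ * V = 1 := (Matrix.mem_orthogonalGroup_iff' (Fin m) ℝ).mp hV
  have key : ∀ u v : Fin m → ℝ, V * Matrix.diagonal u * Vᵀ * (V * Matrix.diagonal v * Vᵀ) =
      V * Matrix.diagonal (fun i => u i * v i) * Vᵀ := by
    intro u v
    rw [← Matrix.diagonal_mul_diagonal]
    simp only [Matrix.mul_assoc]
    rw [← Matrix.mul_assoc Vᵀ V, h1, Matrix.one_mul]
  have hs : ∀ u : Fin m → ℝ, (V * Matrix.diagonal u * Vᵀ).IsSymm := by
    intro u
    rw [Matrix.IsSymm]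
    simp only [Matrix.transpose_mul, Matrix.transpose_transpose, Matrix.diagonal_transpose,
      Matrix.mul_assoc]
  constructor
  · rw [key, key]
    congr 3; funext i
    by_cases h : lam i = 0 <;> simp [h]
  · rw [key, key]
    congr 3; funext i
    by_cases h : lam i = 0 <;> simp [h]
  · rw [key]; exact hs _
  · rw [key]; exact hs _

theorem isPseudoinverse_pinv {A : Matrix (Fin m) (Fin m) ℝ} (hA : A.IsSymm) :
    IsPseudoinverse A (pinv A) := by
  obtain ⟨V, hV, lam, -, h⟩ := exists_sorted_diagonalization hA
  have hex : ∃ X, IsPseudoinverse A X := ⟨_, h ▸ isPseudoinverse_diagonalization hV lam⟩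
  unfold pinv
  rw [dif_pos hex]
  exact hex.choose_spec

/-- The columns of `W` form an orthonormal basis of the space spanned by the eigenvectors that
belong to the `b` smallest eigenvalues (with multiplicity) of the symmetric matrix `M`: for some
orthogonal diagonalization of `M` with non-increasing eigenvalues, it is the span of the last `b`
eigenvectors. -/
def IsSmallestEigenbasis (M : Matrix (Fin m) (Fin m) ℝ) (W : Matrix (Fin m) (Fin b) ℝ) : Prop :=
  Wᵀ * W = 1 ∧
  ∃ V ∈ Matrix.orthogonalGroup (Fin m) ℝ, ∃ lam : Fin m → ℝ, Antitone lam ∧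
    M = V * Matrix.diagonal lam * Vᵀ ∧
    Submodule.span ℝ (Set.range W.col) = Submodule.span ℝ (V.col '' {j | m ≤ (j : ℕ) + b})

/-- A neighbourhood `𝒩` of `M` (in the symmetric matrices: the trace of the open set `nhd`)
together with an analytic map `𝒰` on `𝒩` such that the columns of `𝒰 M` form an orthonormal basis
of `ker M`, and for every `N ∈ 𝒩` the columns of `𝒰 N` form an orthonormal basis of the space
spanned by the eigenvectors of the `b = dim ker M` smallest eigenvalues of `N`. -/
structure KernelFrame (M : Matrix (Fin m) (Fin m) ℝ) (b : ℕ) where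
  nhd : Set (Matrix (Fin m) (Fin m) ℝ)
  isOpen_nhd : IsOpen nhd
  mem_nhd : M ∈ nhd
  toFun : Matrix (Fin m) (Fin m) ℝ → Matrix (Fin m) (Fin b) ℝ
  orthonormal : (toFun M)ᵀ * toFun M = 1
  span_eq_ker : Submodule.span ℝ (Set.range (toFun M).col) = LinearMap.ker M.mulVecLin
  analyticOn : AnalyticOn ℝ toFun (nhd ∩ {N | N.IsSymm})
  isSmallestEigenbasis : ∀ N ∈ nhd, N.IsSymm → IsSmallestEigenbasis N (toFun N)

/-! ### Existence of the analytic frame -/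

theorem contDiff_matMul {E : Type*} [NormedAddCommGroup E] [NormedSpace ℝ E] {k l r : ℕ}
    {s : WithTop ℕ∞} {f : E → Matrix (Fin k) (Fin l) ℝ} {g : E → Matrix (Fin l) (Fin r) ℝ}
    (hf : ContDiff ℝ s f) (hg : ContDiff ℝ s g) : ContDiff ℝ s (fun x => f x * g x) := by
  have hB : IsBoundedBilinearMap ℝ
      (fun q : Matrix (Fin k) (Fin l) ℝ × Matrix (Fin l) (Fin r) ℝ => q.1 * q.2) :=
    { add_left := fun _ _ _ => Matrix.add_mul _ _ _
      smul_left := fun _ _ _ => Matrix.smul_mul _ _ _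
      add_right := fun _ _ _ => Matrix.mul_add _ _ _
      smul_right := fun _ _ _ => Matrix.mul_smul _ _ _
      bound := ⟨1, one_pos, fun x y => by
        rw [one_mul]; exact Matrix.frobenius_norm_mul x y⟩ }
  exact hB.contDiff.comp (hf.prodMk hg)

theorem contDiff_matTranspose {E : Type*} [NormedAddCommGroup E] [NormedSpace ℝ E] {k l : ℕ}
    {s : WithTop ℕ∞} {f : E → Matrix (Fin k) (Fin l) ℝ}
    (hf : ContDiff ℝ s f) : ContDiff ℝ s (fun x => (f x)ᵀ) := by
  have : ContDiff ℝ s (fun A : Matrix (Fin k) (Fin l) ℝ => Aᵀ) :=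
    (Matrix.transposeLinearEquiv (Fin k) (Fin l) ℝ ℝ).toLinearMap.toContinuousLinearMap.contDiff
  exact this.comp hf

/-- The equation that defines the analytic frame implicitly. -/
def frameEq (W₀ : Matrix (Fin m) (Fin b) ℝ)
    (q : Matrix (Fin m) (Fin m) ℝ × Matrix (Fin m) (Fin b) ℝ) : Matrix (Fin m) (Fin b) ℝ :=
  (1 - W₀ * W₀ᵀ) * (q.1 * q.2 - q.2 * (q.2ᵀ * (q.1 * q.2))) +
    W₀ * (q.2ᵀ * q.2 - 1 + (W₀ᵀ * q.2 - q.2ᵀ * W₀))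

theorem contDiff_frameEq (W₀ : Matrix (Fin m) (Fin b) ℝ) {s : WithTop ℕ∞} :
    ContDiff ℝ s (frameEq W₀) := by
  have h1 : ContDiff ℝ s
    (fun q : Matrix (Fin m) (Fin m) ℝ × Matrix (Fin m) (Fin b) ℝ => q.1) := contDiff_fst
  have h2 : ContDiff ℝ s
    (fun q : Matrix (Fin m) (Fin m) ℝ × Matrix (Fin m) (Fin b) ℝ => q.2) := contDiff_snd
  have h2t := contDiff_matTranspose h2
  unfold frameEq
  exact (contDiff_matMul contDiff_const ((contDiff_matMul h1 h2).sub
    (contDiff_matMul h2 (contDiff_matMul h2t (contDiff_matMul h1 h2))))).add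
    (contDiff_matMul contDiff_const (((contDiff_matMul h2t h2).sub contDiff_const).add
      ((contDiff_matMul contDiff_const h2).sub (contDiff_matMul h2t contDiff_const))))

/-- A matrix whose columns lie in the column span of `W` factors through `W`. -/
theorem exists_factor {r : ℕ} {M : Matrix (Fin m) (Fin m) ℝ} {W₀ : Matrix (Fin m) (Fin b) ℝ}
    (hker : Submodule.span ℝ (Set.range W₀.col) = LinearMap.ker M.mulVecLin)
    {D : Matrix (Fin m) (Fin r) ℝ} (hD : M * D = 0) : ∃ Y : Matrix (Fin b) (Fin r) ℝ, D = W₀ * Y := by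
  have h : ∀ j, ∃ y : Fin b → ℝ, W₀ *ᵥ y = D.col j := by
    intro j
    have : D.col j ∈ LinearMap.ker M.mulVecLin := by
      rw [LinearMap.mem_ker, Matrix.mulVecLin_apply]
      funext i
      exact congrFun (congrFun hD i) j
    rw [← hker, ← Matrix.range_mulVecLin] at this
    exact this
  choose y hy using h
  refine ⟨(Matrix.of y)ᵀ, ?_⟩
  ext i j
  exact (congrFun (hy j) i).symm

theorem mul_kernel {M : Matrix (Fin m) (Fin m) ℝ} {W₀ : Matrix (Fin m) (Fin b) ℝ}
    (hker : Submodule.span ℝ (Set.range W₀.col) = LinearMap.ker M.mulVecLin) : M * W₀ = 0 := by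
  ext i j
  have : W₀.col j ∈ LinearMap.ker M.mulVecLin := by
    rw [← hker]; exact Submodule.subset_span ⟨j, rfl⟩
  exact congrFun (LinearMap.mem_ker.mp this) i

theorem isInvertible_frameEq {M : Matrix (Fin m) (Fin m) ℝ} (hM : M.IsSymm)
    {W₀ : Matrix (Fin m) (Fin b) ℝ} (h1 : W₀ᵀ * W₀ = 1)
    (hker : Submodule.span ℝ (Set.range W₀.col) = LinearMap.ker M.mulVecLin) :
    (fderiv ℝ (frameEq W₀) (M, W₀) ∘L .inr ℝ (Matrix (Fin m) (Fin m) ℝ)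
      (Matrix (Fin m) (Fin b) ℝ)).IsInvertible := by
  have hMW : M * W₀ = 0 := mul_kernel hker
  have hWM : W₀ᵀ * M = 0 := by
    have := congrArg Matrix.transpose hMW
    rwa [Matrix.transpose_mul, hM.eq, Matrix.transpose_zero] at this
  set T := fderiv ℝ (frameEq W₀) (M, W₀) ∘L .inr ℝ (Matrix (Fin m) (Fin m) ℝ)
      (Matrix (Fin m) (Fin b) ℝ) with hT
  have hval : ∀ D, T D = M * D + (2 : ℝ) • (W₀ * (W₀ᵀ * D)) := by
    intro D
    have hd := ((contDiff_frameEq W₀ (s := 1)).differentiable one_ne_zero (M, W₀)).hasFDerivAt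
    have hline : HasDerivAt (fun t : ℝ => ((M, W₀) : _ × _) + t • ((0, D) : _ × _)) (0, D) 0 := by
      have := ((hasDerivAt_id (0 : ℝ)).smul_const
        ((0, D) : Matrix (Fin m) (Fin m) ℝ × Matrix (Fin m) (Fin b) ℝ)).const_add (M, W₀)
      rw [one_smul] at this
      exact this
    have hcomp : HasDerivAt (fun t : ℝ => frameEq W₀ ((M, W₀) + t • ((0, D) : _ × _))) (T D) 0 := by
      have := HasFDerivAt.comp_hasDerivAt (x := (0 : ℝ)) (f := fun t : ℝ =>
        ((M, W₀) : Matrix (Fin m) (Fin m) ℝ × Matrix (Fin m) (Fin b) ℝ) + t • ((0, D) : _ × _))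
        (l := frameEq W₀) (l' := fderiv ℝ (frameEq W₀) (M, W₀)) (by simpa using hd) hline
      exact this
    let B : Matrix (Fin m) (Fin b) ℝ :=
      W₀ * (Dᵀ * D) - (1 - W₀ * W₀ᵀ) * (W₀ * (Dᵀ * (M * D)))
    let C : Matrix (Fin m) (Fin b) ℝ := - ((1 - W₀ * W₀ᵀ) * (D * (Dᵀ * (M * D))))
    have hpoly : (fun t : ℝ => frameEq W₀ ((M, W₀) + t • ((0, D) : _ × _))) =
        fun t : ℝ => t • (M * D + (2 : ℝ) • (W₀ * (W₀ᵀ * D))) + t ^ 2 • B + t ^ 3 • C := by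
      funext t
      have e1 : M * (W₀ + t • D) = t • (M * D) := by
        rw [Matrix.mul_add, hMW, zero_add, Matrix.mul_smul]
      have e2 : (W₀ + t • D)ᵀ * (M * (W₀ + t • D)) = t ^ 2 • (Dᵀ * (M * D)) := by
        rw [e1, Matrix.transpose_add, Matrix.transpose_smul, Matrix.add_mul, Matrix.mul_smul,
          ← Matrix.mul_assoc W₀ᵀ, hWM, Matrix.zero_mul, smul_zero, zero_add, Matrix.smul_mul,
          Matrix.mul_smul, smul_smul, pow_two]
      have e3 : (W₀ + t • D)ᵀ * (W₀ + t • D) - 1 +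
          (W₀ᵀ * (W₀ + t • D) - (W₀ + t • D)ᵀ * W₀) =
          t • ((2 : ℝ) • (W₀ᵀ * D)) + t ^ 2 • (Dᵀ * D) := by
        simp only [Matrix.transpose_add, Matrix.transpose_smul, Matrix.add_mul, Matrix.mul_add,
          Matrix.mul_smul, Matrix.smul_mul, h1, smul_smul]
        module
      have e4 : (1 - W₀ * W₀ᵀ) * (M * D) = M * D := by
        rw [Matrix.sub_mul, Matrix.one_mul, Matrix.mul_assoc, ← Matrix.mul_assoc W₀ᵀ, hWM,
          Matrix.zero_mul, Matrix.mul_zero, sub_zero]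
      have e0 : ((M, W₀) : _ × _) + t • ((0, D) : _ × _) = (M, W₀ + t • D) := by simp
      rw [e0]
      simp only [frameEq]
      rw [e2, e3, e1, Matrix.mul_sub, Matrix.mul_smul, e4, Matrix.add_mul]
      simp only [B, C, Matrix.mul_add, Matrix.mul_smul, Matrix.smul_mul]
      module
    rw [hpoly] at hcomp
    have hd2 : HasDerivAt (fun t : ℝ => t • (M * D + (2 : ℝ) • (W₀ * (W₀ᵀ * D))) + t ^ 2 • B +
        t ^ 3 • C) (M * D + (2 : ℝ) • (W₀ * (W₀ᵀ * D))) 0 := by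
      have a1 := (hasDerivAt_id (0 : ℝ)).smul_const (M * D + (2 : ℝ) • (W₀ * (W₀ᵀ * D)))
      have a2 := (hasDerivAt_pow 2 (0 : ℝ)).smul_const B
      have a3 := (hasDerivAt_pow 3 (0 : ℝ)).smul_const C
      refine ((a1.add a2).add a3).congr_deriv ?_
      simp
    exact hcomp.unique hd2
  have hinj : Function.Injective T.toLinearMap := by
    rw [← LinearMap.ker_eq_bot, LinearMap.ker_eq_bot']
    intro D hD
    have hD' : M * D + (2 : ℝ) • (W₀ * (W₀ᵀ * D)) = 0 := by rw [← hval]; exact hD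
    have e1 : W₀ᵀ * D = 0 := by
      have := congrArg (fun X => W₀ᵀ * X) hD'
      simp only [Matrix.mul_add, Matrix.mul_smul, Matrix.mul_zero] at this
      rw [← Matrix.mul_assoc, hWM, Matrix.zero_mul, zero_add, ← Matrix.mul_assoc W₀ᵀ, h1,
        Matrix.one_mul] at this
      exact (smul_eq_zero.mp this).resolve_left two_ne_zero
    rw [e1, Matrix.mul_zero, smul_zero, add_zero] at hD'
    obtain ⟨Y, rfl⟩ := exists_factor hker hD'
    rw [← Matrix.mul_assoc, h1, Matrix.one_mul] at e1
    rw [e1, Matrix.mul_zero]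
  let e : Matrix (Fin m) (Fin b) ℝ ≃ₗ[ℝ] Matrix (Fin m) (Fin b) ℝ :=
    LinearEquiv.ofInjectiveEndo T.toLinearMap hinj
  refine ⟨e.toContinuousLinearEquiv, ?_⟩
  ext1 D
  rfl

/-- Solutions of `frameEq` near the base point are orthonormal and span invariant subspaces. -/
theorem frameEq_zero {N : Matrix (Fin m) (Fin m) ℝ} {W₀ W : Matrix (Fin m) (Fin b) ℝ}
    (h1 : W₀ᵀ * W₀ = 1) (h : frameEq W₀ (N, W) = 0) (hdet : (Wᵀ * W₀).det ≠ 0) :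
    Wᵀ * W = 1 ∧ N * W = W * (Wᵀ * (N * W)) := by
  have hP : W₀ᵀ * (1 - W₀ * W₀ᵀ) = 0 := by
    rw [Matrix.mul_sub, ← Matrix.mul_assoc, h1, Matrix.mul_one, Matrix.one_mul, sub_self]
  simp only [frameEq] at h
  have hE : Wᵀ * W - 1 + (W₀ᵀ * W - Wᵀ * W₀) = 0 := by
    have := congrArg (fun X => W₀ᵀ * X) h
    simp only [Matrix.mul_add W₀ᵀ, Matrix.mul_zero] at this
    rwa [← Matrix.mul_assoc, hP, Matrix.zero_mul, zero_add, ← Matrix.mul_assoc, h1,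
      Matrix.one_mul] at this
  have hE' : Wᵀ * W - 1 + (Wᵀ * W₀ - W₀ᵀ * W) = 0 := by
    have := congrArg Matrix.transpose hE
    simpa [Matrix.transpose_mul] using this
  have hW : Wᵀ * W = 1 := by
    have : (2 : ℝ) • (Wᵀ * W - 1) = 0 := by
      rw [two_smul]
      calc _ = (Wᵀ * W - 1 + (W₀ᵀ * W - Wᵀ * W₀)) + (Wᵀ * W - 1 + (Wᵀ * W₀ - W₀ᵀ * W)) := by abel
        _ = 0 := by rw [hE, hE', add_zero]
    exact sub_eq_zero.mp ((smul_eq_zero.mp this).resolve_left two_ne_zero)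
  refine ⟨hW, ?_⟩
  rw [hE, Matrix.mul_zero, add_zero] at h
  set R := N * W - W * (Wᵀ * (N * W)) with hR
  have hWR : Wᵀ * R = 0 := by
    rw [hR, Matrix.mul_sub, ← Matrix.mul_assoc Wᵀ W, hW, Matrix.one_mul, sub_self]
  have hR2 : R = W₀ * (W₀ᵀ * R) := by
    rw [Matrix.sub_mul, Matrix.one_mul, Matrix.mul_assoc] at h
    exact sub_eq_zero.mp h
  have hz : (Wᵀ * W₀) * (W₀ᵀ * R) = 0 := by
    rw [Matrix.mul_assoc, ← hR2, hWR]
  have hz2 : W₀ᵀ * R = 0 := by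
    have hu : IsUnit (Wᵀ * W₀).det := isUnit_iff_ne_zero.mpr hdet
    calc W₀ᵀ * R = (Wᵀ * W₀)⁻¹ * ((Wᵀ * W₀) * (W₀ᵀ * R)) := by
          rw [← Matrix.mul_assoc, Matrix.nonsing_inv_mul _ hu, Matrix.one_mul]
      _ = 0 := by rw [hz, Matrix.mul_zero]
  rw [hz2, Matrix.mul_zero] at hR2
  exact sub_eq_zero.mp hR2

/-- An orthonormal basis of an invariant subspace of `N` on which `N` is small, while `N` is large
on the orthogonal complement, spans the eigenspace of the smallest eigenvalues. -/
theorem isSmallestEigenbasis_of_gap {N : Matrix (Fin m) (Fin m) ℝ} (hN : N.IsSymm)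
    {W : Matrix (Fin m) (Fin b) ℝ} (hW : Wᵀ * W = 1) (hinv : N * W = W * (Wᵀ * (N * W)))
    {c : ℝ}
    (hbig : ∀ v : Fin m → ℝ, 2 * c * (v ⬝ᵥ v) ≤ v ⬝ᵥ ((N + W * Wᵀ) *ᵥ v))
    (hc : 0 < c)
    (hsmall : ∀ y : Fin b → ℝ, y ⬝ᵥ ((Wᵀ * (N * W)) *ᵥ y) ≤ c * (y ⬝ᵥ y)) :
    IsSmallestEigenbasis N W := by
  obtain ⟨V, hV, lam, hlam, hdec⟩ := exists_sorted_diagonalization hN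
  have hVV : Vᵀ * V = 1 := (Matrix.mem_orthogonalGroup_iff' (Fin m) ℝ).mp hV
  have hVV' : V * Vᵀ = 1 := (Matrix.mem_orthogonalGroup_iff (Fin m) ℝ).mp hV
  have heig : ∀ j, N *ᵥ V.col j = lam j • V.col j := by
    intro j
    have h0 : N * V = V * Matrix.diagonal lam := by
      rw [hdec, Matrix.mul_assoc, hVV, Matrix.mul_one]
    funext i
    have := congrFun (congrFun h0 i) j
    rw [Matrix.mul_diagonal] at this
    rw [Pi.smul_apply, smul_eq_mul, mul_comm]
    exact this
  have hTsymm : (Wᵀ * (N * W))ᵀ = Wᵀ * (N * W) := by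
    simp only [Matrix.transpose_mul, Matrix.transpose_transpose, hN.eq, Matrix.mul_assoc]
  have hWN : Wᵀ * N = (Wᵀ * (N * W)) * Wᵀ := by
    have := congrArg Matrix.transpose hinv
    rw [Matrix.transpose_mul W, hTsymm, Matrix.transpose_mul, hN.eq] at this
    exact this
  have hTy : ∀ j, (Wᵀ * (N * W)) *ᵥ (Wᵀ *ᵥ V.col j) = lam j • (Wᵀ *ᵥ V.col j) := by
    intro j
    rw [Matrix.mulVec_mulVec, ← hWN, ← Matrix.mulVec_mulVec, heig, Matrix.mulVec_smul]
  -- large eigenvalues: the eigenvector is orthogonal to the columns of W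
  have hlarge : ∀ j, 2 * c ≤ lam j → Wᵀ *ᵥ V.col j = 0 := by
    intro j hj
    have h := hsmall (Wᵀ *ᵥ V.col j)
    rw [hTy, dotProduct_smul, smul_eq_mul] at h
    by_contra hne
    have hpos : 0 < (Wᵀ *ᵥ V.col j) ⬝ᵥ (Wᵀ *ᵥ V.col j) := by
      have h0 : 0 ≤ (Wᵀ *ᵥ V.col j) ⬝ᵥ (Wᵀ *ᵥ V.col j) :=
        Finset.sum_nonneg fun i _ => mul_self_nonneg _
      exact lt_of_le_of_ne h0 fun he => hne (dotProduct_self_eq_zero.mp he.symm)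
    nlinarith
  -- small eigenvalues: the eigenvector lies in the span of the columns of W
  have hlow : ∀ j, lam j < 2 * c → V.col j = W *ᵥ (Wᵀ *ᵥ V.col j) := by
    intro j hj
    set y := Wᵀ *ᵥ V.col j with hy
    have hu1 : N *ᵥ (V.col j - W *ᵥ y) = lam j • (V.col j - W *ᵥ y) := by
      rw [Matrix.mulVec_sub, heig, Matrix.mulVec_mulVec, hinv, ← Matrix.mulVec_mulVec, hTy,
        Matrix.mulVec_smul, smul_sub]
    have hu2 : Wᵀ *ᵥ (V.col j - W *ᵥ y) = 0 := by
      rw [Matrix.mulVec_sub, Matrix.mulVec_mulVec, hW, Matrix.one_mulVec, ← hy, sub_self]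
    have h := hbig (V.col j - W *ᵥ y)
    rw [Matrix.add_mulVec, hu1, ← Matrix.mulVec_mulVec, hu2, Matrix.mulVec_zero, add_zero,
      dotProduct_smul, smul_eq_mul] at h
    have h0 : 0 ≤ (V.col j - W *ᵥ y) ⬝ᵥ (V.col j - W *ᵥ y) :=
      Finset.sum_nonneg fun i _ => mul_self_nonneg _
    have hz : (V.col j - W *ᵥ y) ⬝ᵥ (V.col j - W *ᵥ y) = 0 := by nlinarith
    exact sub_eq_zero.mp (dotProduct_self_eq_zero.mp hz)
  have hspan : Submodule.span ℝ (Set.range W.col) =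
      Submodule.span ℝ (V.col '' {j | lam j < 2 * c}) := by
    apply le_antisymm
    · rw [Submodule.span_le]
      rintro _ ⟨i, rfl⟩
      have hexp : W.col i = ∑ j, (Wᵀ *ᵥ V.col j) i • V.col j := by
        have h0 : W = V * (Vᵀ * W) := by rw [← Matrix.mul_assoc, hVV', Matrix.one_mul]
        funext k
        have := congrFun (congrFun h0 k) i
        rw [Finset.sum_apply]
        refine this.trans ?_
        rw [Matrix.mul_apply]
        refine Finset.sum_congr rfl fun j _ => ?_
        rw [Pi.smul_apply, smul_eq_mul, mul_comm]
        congr 1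
        simp [Matrix.mul_apply, Matrix.mulVec, dotProduct, mul_comm, Matrix.col]
      rw [SetLike.mem_coe, hexp]
      refine Submodule.sum_mem _ fun j _ => ?_
      by_cases hj : lam j < 2 * c
      · exact Submodule.smul_mem _ _ (Submodule.subset_span ⟨j, hj, rfl⟩)
      · rw [hlarge j (not_lt.mp hj), Pi.zero_apply, zero_smul]
        exact Submodule.zero_mem _
    · rw [Submodule.span_le]
      rintro _ ⟨j, hj, rfl⟩
      rw [SetLike.mem_coe, hlow j hj, ← Matrix.range_mulVecLin]
      exact ⟨_, rfl⟩
  have hindV : LinearIndependent ℝ V.col := by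
    apply Matrix.linearIndependent_cols_of_isUnit
    exact ⟨⟨V, Vᵀ, hVV', hVV⟩, rfl⟩
  have hindW : LinearIndependent ℝ W.col := by
    rw [← Matrix.mulVec_injective_iff]
    intro y z hyz
    have := congrArg (fun v => Wᵀ *ᵥ v) hyz
    simpa [Matrix.mulVec_mulVec, hW] using this
  have hcard : (Finset.univ.filter fun j => lam j < 2 * c).card = b := by
    have f1 : Module.finrank ℝ (Submodule.span ℝ (Set.range W.col)) = b := by
      rw [finrank_span_eq_card hindW, Fintype.card_fin]
    have f2 : Module.finrank ℝ (Submodule.span ℝ (V.col '' {j | lam j < 2 * c})) =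
        (Finset.univ.filter fun j => lam j < 2 * c).card := by
      have hi : LinearIndependent ℝ (fun j : {j | lam j < 2 * c} => V.col j) :=
        hindV.comp _ Subtype.val_injective
      have := finrank_span_eq_card hi
      rw [Set.image_eq_range]
      rw [this, Fintype.card_subtype]
      simp
    rw [← f2, ← hspan, f1]
  have hset : {j : Fin m | lam j < 2 * c} = {j : Fin m | m ≤ (j : ℕ) + b} := by
    set J := Finset.univ.filter fun j => lam j < 2 * c with hJ
    ext j
    simp only [Set.mem_ofPred_eq]
    constructor
    · intro hj
      have hsub : Finset.Ici j ⊆ J := by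
        intro i hi
        rw [hJ, Finset.mem_filter]
        exact ⟨Finset.mem_univ _, lt_of_le_of_lt (hlam (Finset.mem_Ici.mp hi)) hj⟩
      have := Finset.card_le_card hsub
      rw [hcard, Fin.card_Ici] at this
      omega
    · intro hj
      by_contra hn
      have hsub : J ⊆ Finset.Ioi j := by
        intro i hi
        rw [hJ, Finset.mem_filter] at hi
        rw [Finset.mem_Ioi]
        by_contra hle
        exact hn (lt_of_le_of_lt (hlam (not_lt.mp hle)) hi.2)
      have := Finset.card_le_card hsub
      rw [hcard, Fin.card_Ioi] at this
      have := j.2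
      omega
  exact ⟨hW, V, hV, lam, hlam, hdec, hset ▸ hspan⟩

theorem abs_quadForm_le {k : ℕ} (B : Matrix (Fin k) (Fin k) ℝ) (v : Fin k → ℝ) :
    |v ⬝ᵥ (B *ᵥ v)| ≤ (∑ i, ∑ j, |B i j|) * (v ⬝ᵥ v) := by
  have hle : ∀ i j, |v i * v j| ≤ v ⬝ᵥ v := by
    intro i j
    have h : ∀ i, v i * v i ≤ v ⬝ᵥ v := fun i =>
      Finset.single_le_sum (f := fun i => v i * v i) (fun i _ => mul_self_nonneg _)
        (Finset.mem_univ i)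
    rw [abs_mul]
    have h1 := h i
    have h2 := h j
    nlinarith [sq_nonneg (|v i| - |v j|), abs_mul_abs_self (v i), abs_mul_abs_self (v j)]
  calc |v ⬝ᵥ (B *ᵥ v)| = |∑ i, ∑ j, B i j * (v i * v j)| := by
        congr 1
        simp only [dotProduct, Matrix.mulVec, Finset.mul_sum]
        exact Finset.sum_congr rfl fun i _ => Finset.sum_congr rfl fun j _ => by ring
    _ ≤ ∑ i, ∑ j, |B i j * (v i * v j)| :=
        (Finset.abs_sum_le_sum_abs _ _).trans
          (Finset.sum_le_sum fun i _ => Finset.abs_sum_le_sum_abs _ _)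
    _ ≤ ∑ i, ∑ j, |B i j| * (v ⬝ᵥ v) := by
        refine Finset.sum_le_sum fun i _ => Finset.sum_le_sum fun j _ => ?_
        rw [abs_mul]
        exact mul_le_mul_of_nonneg_left (hle i j) (abs_nonneg _)
    _ = (∑ i, ∑ j, |B i j|) * (v ⬝ᵥ v) := by
        simp only [Finset.sum_mul]

theorem exists_quadForm_lower {A : Matrix (Fin m) (Fin m) ℝ} (hA : A.IsSymm)
    (hpos : ∀ v : Fin m → ℝ, v ≠ 0 → 0 < v ⬝ᵥ (A *ᵥ v)) :
    ∃ c > 0, ∀ v : Fin m → ℝ, c * (v ⬝ᵥ v) ≤ v ⬝ᵥ (A *ᵥ v) := by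
  obtain ⟨V, hV, lam, -, hdec⟩ := exists_sorted_diagonalization hA
  have hVV : Vᵀ * V = 1 := (Matrix.mem_orthogonalGroup_iff' (Fin m) ℝ).mp hV
  have hVV' : V * Vᵀ = 1 := (Matrix.mem_orthogonalGroup_iff (Fin m) ℝ).mp hV
  have hq : ∀ v : Fin m → ℝ, v ⬝ᵥ (A *ᵥ v) = ∑ i, lam i * ((Vᵀ *ᵥ v) i * (Vᵀ *ᵥ v) i) := by
    intro v
    rw [hdec, ← Matrix.mulVec_mulVec, ← Matrix.mulVec_mulVec, Matrix.dotProduct_mulVec,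
      ← Matrix.mulVec_transpose]
    simp only [dotProduct, Matrix.mulVec_diagonal]
    exact Finset.sum_congr rfl fun i _ => by ring
  have hn : ∀ v : Fin m → ℝ, v ⬝ᵥ v = ∑ i, (Vᵀ *ᵥ v) i * (Vᵀ *ᵥ v) i := by
    intro v
    change _ = (Vᵀ *ᵥ v) ⬝ᵥ (Vᵀ *ᵥ v)
    rw [Matrix.mulVec_transpose, ← Matrix.dotProduct_mulVec, ← Matrix.mulVec_transpose,
      Matrix.mulVec_mulVec, hVV', Matrix.one_mulVec]
  have hl : ∀ i, 0 < lam i := by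
    intro i
    have hv : Vᵀ *ᵥ (V *ᵥ Pi.single i 1) = Pi.single i 1 := by
      rw [Matrix.mulVec_mulVec, hVV, Matrix.one_mulVec]
    have h := hpos (V *ᵥ Pi.single i 1) (by
      intro h0
      rw [h0, Matrix.mulVec_zero] at hv
      have := congrFun hv i
      simp at this)
    rw [hq, hv] at h
    simpa [Pi.single_apply] using h
  obtain ⟨c, hc, hcl⟩ : ∃ c > 0, ∀ i, c ≤ lam i := by
    rcases isEmpty_or_nonempty (Fin m) with he | he
    · exact ⟨1, one_pos, fun i => he.elim i⟩
    · obtain ⟨i, hi⟩ := Finite.exists_min lam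
      exact ⟨lam i, hl i, hi⟩
  refine ⟨c, hc, fun v => ?_⟩
  rw [hq, hn, Finset.mul_sum]
  exact Finset.sum_le_sum fun i _ => mul_le_mul_of_nonneg_right (hcl i) (mul_self_nonneg _)

/-- Existence of the analytic frame, with prescribed value `W₀` at `M`. -/
theorem exists_kernelFrame {M : Matrix (Fin m) (Fin m) ℝ} (hM : M.PosSemidef)
    {W₀ : Matrix (Fin m) (Fin b) ℝ} (h1 : W₀ᵀ * W₀ = 1)
    (hker : Submodule.span ℝ (Set.range W₀.col) = LinearMap.ker M.mulVecLin) :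
    ∃ U : KernelFrame M b, U.toFun M = W₀ := by
  have hsymm : M.IsSymm := by
    have := hM.isHermitian
    rwa [Matrix.IsHermitian, Matrix.conjTranspose_eq_transpose_of_trivial] at this
  have hMW : M * W₀ = 0 := mul_kernel hker
  -- the gap constant
  obtain ⟨c, hc, hcb⟩ : ∃ c > 0, ∀ v : Fin m → ℝ,
      c * (v ⬝ᵥ v) ≤ v ⬝ᵥ ((M + W₀ * W₀ᵀ) *ᵥ v) := by
    apply exists_quadForm_lower
    · rw [Matrix.IsSymm, Matrix.transpose_add, Matrix.transpose_mul, Matrix.transpose_transpose,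
        hsymm.eq]
    · intro v hv
      have hMv : 0 ≤ v ⬝ᵥ (M *ᵥ v) := by simpa using hM.dotProduct_mulVec_nonneg v
      have hsq : v ⬝ᵥ ((W₀ * W₀ᵀ) *ᵥ v) = (W₀ᵀ *ᵥ v) ⬝ᵥ (W₀ᵀ *ᵥ v) := by
        rw [← Matrix.mulVec_mulVec, Matrix.dotProduct_mulVec, Matrix.mulVec_transpose]
      have hsq0 : 0 ≤ (W₀ᵀ *ᵥ v) ⬝ᵥ (W₀ᵀ *ᵥ v) :=
        Finset.sum_nonneg fun i _ => mul_self_nonneg _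
      rw [Matrix.add_mulVec, dotProduct_add, hsq]
      refine lt_of_le_of_ne (add_nonneg hMv hsq0) fun he => hv ?_
      have z1 : v ⬝ᵥ (M *ᵥ v) = 0 := by linarith
      have z2 : W₀ᵀ *ᵥ v = 0 := dotProduct_self_eq_zero.mp (by linarith)
      have z3 : M *ᵥ v = 0 := (hM.dotProduct_mulVec_zero_iff v).mp (by simpa using z1)
      have hvk : v ∈ LinearMap.ker M.mulVecLin := z3
      rw [← hker, ← Matrix.range_mulVecLin] at hvk
      obtain ⟨y, rfl⟩ := hvk
      rw [Matrix.mulVecLin_apply, Matrix.mulVec_mulVec, h1, Matrix.one_mulVec] at z2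
      rw [z2, map_zero]
  -- the implicit function
  have cdf : ContDiffAt ℝ ⊤ (frameEq W₀) (M, W₀) := (contDiff_frameEq W₀).contDiffAt
  have hne : (⊤ : WithTop ℕ∞) ≠ 0 := by simp
  have hinv := isInvertible_frameEq hsymm h1 hker
  set ψ := cdf.implicitFunction hne hinv with hψ
  have hψM : ψ M = W₀ := cdf.implicitFunction_apply_self hne hinv
  have hψa : AnalyticAt ℝ ψ M :=
    (cdf.contDiffAt_implicitFunction hne hinv).analyticAt
  have hψc : ContinuousAt ψ M := hψa.continuousAt
  have hzero : ∀ᶠ N in 𝓝 M, frameEq W₀ (N, ψ N) = 0 := by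
    have h0 : frameEq W₀ (M, W₀) = 0 := by
      simp [frameEq, hMW, h1]
    filter_upwards [cdf.eventually_apply_implicitFunction hne hinv] with N hN
    rw [← h0]; exact hN
  have hdet : ∀ᶠ N in 𝓝 M, ((ψ N)ᵀ * W₀).det ≠ 0 := by
    have hcont : ContinuousAt (fun N => ((ψ N)ᵀ * W₀).det) M := by fun_prop
    refine hcont.eventually_ne ?_
    rw [hψM, h1, Matrix.det_one]
    exact one_ne_zero
  have hbig : ∀ᶠ N in 𝓝 M, ∑ i, ∑ j, |((N + ψ N * (ψ N)ᵀ) - (M + W₀ * W₀ᵀ)) i j| < c / 2 := by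
    have hcont : ContinuousAt
        (fun N => ∑ i, ∑ j, |((N + ψ N * (ψ N)ᵀ) - (M + W₀ * W₀ᵀ)) i j|) M := by fun_prop
    refine hcont.eventually_lt_const ?_
    simp [hψM, half_pos hc]
  have hsmall : ∀ᶠ N in 𝓝 M, ∑ i, ∑ j, |((ψ N)ᵀ * (N * ψ N)) i j| < c / 4 := by
    have hcont : ContinuousAt (fun N => ∑ i, ∑ j, |((ψ N)ᵀ * (N * ψ N)) i j|) M := by fun_prop
    refine hcont.eventually_lt_const ?_
    simp [hψM, hMW, hc]
  obtain ⟨O, hO, hOo, hMO⟩ := eventually_nhds_iff.mp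
    (hψa.eventually_analyticAt.and (hzero.and (hdet.and (hbig.and hsmall))))
  refine ⟨⟨O, hOo, hMO, ψ, by rw [hψM, h1], by rw [hψM, hker],
    fun N hN => (hO N hN.1).1.analyticWithinAt, fun N hN hNs => ?_⟩, hψM⟩
  obtain ⟨-, n1, n2, n3, n4⟩ := hO N hN
  obtain ⟨w1, w2⟩ := frameEq_zero h1 n1 n2
  refine isSmallestEigenbasis_of_gap hNs w1 w2 (c := c / 4) (fun v => ?_) (by positivity)
    (fun y => ?_)
  · have q1 := abs_quadForm_le ((N + ψ N * (ψ N)ᵀ) - (M + W₀ * W₀ᵀ)) v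
    rw [Matrix.sub_mulVec, dotProduct_sub] at q1
    have q2 := hcb v
    have hv : 0 ≤ v ⬝ᵥ v := Finset.sum_nonneg fun i _ => mul_self_nonneg _
    have q3 := mul_le_mul_of_nonneg_right n3.le hv
    have q4 := (abs_le.mp q1).1
    linarith
  · have q1 := (abs_le.mp (abs_quadForm_le ((ψ N)ᵀ * (N * ψ N)) y)).2
    have hy : 0 ≤ y ⬝ᵥ y := Finset.sum_nonneg fun i _ => mul_self_nonneg _
    exact q1.trans (mul_le_mul_of_nonneg_right n4.le hy)

/-- Every positive semidefinite matrix has a kernel frame. -/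
theorem nonempty_kernelFrame {M : Matrix (Fin m) (Fin m) ℝ} (hM : M.PosSemidef) :
    ∃ b, Nonempty (KernelFrame M b) := by
  let K : Submodule ℝ (EuclideanSpace ℝ (Fin m)) := LinearMap.ker (Matrix.toLpLin 2 2 M)
  obtain ⟨r, ⟨B⟩⟩ : ∃ r, Nonempty (OrthonormalBasis (Fin r) ℝ K) :=
    ⟨_, ⟨stdOrthonormalBasis ℝ K⟩⟩
  let W₀ : Matrix (Fin m) (Fin r) ℝ :=
    Matrix.of fun i j => (B j : EuclideanSpace ℝ (Fin m)) i
  have h1 : W₀ᵀ * W₀ = 1 := by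
    ext i j
    have := orthonormal_iff_ite.mp B.orthonormal j i
    rw [Submodule.coe_inner, PiLp.inner_apply] at this
    rw [Matrix.mul_apply, Matrix.one_apply]
    rw [if_congr (eq_comm (a := j) (b := i)) rfl rfl] at this
    rw [← this]
    refine Finset.sum_congr rfl fun x _ => ?_
    rw [RCLike.inner_apply, conj_trivial]
    rfl
  have hker : Submodule.span ℝ (Set.range W₀.col) = LinearMap.ker M.mulVecLin := by
    apply le_antisymm
    · rw [Submodule.span_le]
      rintro _ ⟨j, rfl⟩
      have := (B j).2
      exact congrArg WithLp.ofLp (LinearMap.mem_ker.mp this)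
    · intro v hv
      have hv' : WithLp.toLp 2 v ∈ K := by
        rw [LinearMap.mem_ker]
        exact congrArg (WithLp.toLp 2) (LinearMap.mem_ker.mp hv)
      have hs := B.sum_repr ⟨WithLp.toLp 2 v, hv'⟩
      have hs' : v = ∑ j, B.repr ⟨WithLp.toLp 2 v, hv'⟩ j • W₀.col j := by
        funext i
        have h2 := congrArg (fun z : K => (z : EuclideanSpace ℝ (Fin m)) i) hs.symm
        simp only [AddSubmonoidClass.coe_finsetSum, Submodule.coe_smul, WithLp.ofLp_sum,
          WithLp.ofLp_smul, Finset.sum_apply, Pi.smul_apply] at h2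
        rw [Finset.sum_apply]
        exact h2
      rw [hs']
      exact Submodule.sum_mem _ fun j _ =>
        Submodule.smul_mem _ _ (Submodule.subset_span ⟨j, rfl⟩)
  obtain ⟨U, -⟩ := exists_kernelFrame hM h1 hker
  exact ⟨_, ⟨U⟩⟩

end LinearAlgebra

/-! ### The problem: minimize `f x` subject to `h x = 0`, `G x ⪰ 0` -/

section Problem

variable {n p m : ℕ}

/-- The feasible set. -/
def feasibleSet (h : EuclideanSpace ℝ (Fin n) → EuclideanSpace ℝ (Fin p))
    (G : EuclideanSpace ℝ (Fin n) → Matrix (Fin m) (Fin m) ℝ) : Set (EuclideanSpace ℝ (Fin n)) :=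
  {x | h x = 0 ∧ (G x).PosSemidef}

/-- `x̄` is a local minimizer of the problem. -/
def IsLocalMinimizer (f : EuclideanSpace ℝ (Fin n) → ℝ)
    (h : EuclideanSpace ℝ (Fin n) → EuclideanSpace ℝ (Fin p))
    (G : EuclideanSpace ℝ (Fin n) → Matrix (Fin m) (Fin m) ℝ)
    (xbar : EuclideanSpace ℝ (Fin n)) : Prop :=
  xbar ∈ feasibleSet h G ∧ IsLocalMinOn f (feasibleSet h G) xbar

/-- The Lagrangian `L(x, μ, Ω) = f(x) - ⟨h(x), μ⟩ - ⟨G(x), Ω⟩`. -/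
def lagrangian (f : EuclideanSpace ℝ (Fin n) → ℝ)
    (h : EuclideanSpace ℝ (Fin n) → EuclideanSpace ℝ (Fin p))
    (G : EuclideanSpace ℝ (Fin n) → Matrix (Fin m) (Fin m) ℝ)
    (x : EuclideanSpace ℝ (Fin n)) (μ : EuclideanSpace ℝ (Fin p))
    (Ω : Matrix (Fin m) (Fin m) ℝ) : ℝ :=
  f x - inner ℝ (h x) μ - matInner (G x) Ω

/-- The partial derivative `∂ᵢ φ (x)`. -/
def pderiv {E : Type*} [NormedAddCommGroup E] [NormedSpace ℝ E]
    (φ : EuclideanSpace ℝ (Fin n) → E) (i : Fin n) (x : EuclideanSpace ℝ (Fin n)) : E :=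
  fderiv ℝ φ x (EuclideanSpace.single i 1)

/-- The Hessian matrix `[∂ᵢ ∂ⱼ φ (x)]`. -/
def hessian (φ : EuclideanSpace ℝ (Fin n) → ℝ) (x : EuclideanSpace ℝ (Fin n)) :
    Matrix (Fin n) (Fin n) ℝ :=
  Matrix.of fun i j => pderiv (pderiv φ j) i x

/-- The sigma-term `σ(x, Ω) = [2 ⟨Ω, ∂ᵢ G(x) G(x)† ∂ⱼ G(x)⟩]`. -/
def sigmaTerm (G : EuclideanSpace ℝ (Fin n) → Matrix (Fin m) (Fin m) ℝ)
    (x : EuclideanSpace ℝ (Fin n)) (Ω : Matrix (Fin m) (Fin m) ℝ) : Matrix (Fin n) (Fin n) ℝ :=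
  Matrix.of fun i j => 2 * matInner Ω (pderiv G i x * pinv (G x) * pderiv G j x)

/-- The perturbed critical subspace `S(x, x̄)`: the `d` with `Dh(x) d = 0` and
`𝒰(G(x))ᵀ DG(x)[d] 𝒰(G(x)) = 0`. -/
def criticalSubspace (h : EuclideanSpace ℝ (Fin n) → EuclideanSpace ℝ (Fin p))
    (G : EuclideanSpace ℝ (Fin n) → Matrix (Fin m) (Fin m) ℝ)
    {xbar : EuclideanSpace ℝ (Fin n)} {b : ℕ} (U : KernelFrame (G xbar) b)
    (x : EuclideanSpace ℝ (Fin n)) : Set (EuclideanSpace ℝ (Fin n)) :=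
  {d | fderiv ℝ h x d = 0 ∧ (U.toFun (G x))ᵀ * fderiv ℝ G x d * U.toFun (G x) = 0}

/-- `(xᵏ, μᵏ, Ωₖ)` is an AKKT sequence corresponding to `x̄`. -/
structure IsAKKTSeq (f : EuclideanSpace ℝ (Fin n) → ℝ)
    (h : EuclideanSpace ℝ (Fin n) → EuclideanSpace ℝ (Fin p))
    (G : EuclideanSpace ℝ (Fin n) → Matrix (Fin m) (Fin m) ℝ)
    (xbar : EuclideanSpace ℝ (Fin n))
    (x : ℕ → EuclideanSpace ℝ (Fin n)) (μ : ℕ → EuclideanSpace ℝ (Fin p))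
    (Ω : ℕ → Matrix (Fin m) (Fin m) ℝ) : Prop where
  posSemidef : ∀ k, (Ω k).PosSemidef
  tendsto_x : Tendsto x atTop (𝓝 xbar)
  tendsto_gradient :
    Tendsto (fun k => gradient (fun y => lagrangian f h G y (μ k) (Ω k)) (x k)) atTop (𝓝 0)
  complementarity :
    ∃ U ∈ Matrix.orthogonalGroup (Fin m) ℝ, ∃ lam : Fin m → ℝ,
    ∃ Uk : ℕ → Matrix (Fin m) (Fin m) ℝ, ∃ om : ℕ → Fin m → ℝ,
      (∀ k, Uk k ∈ Matrix.orthogonalGroup (Fin m) ℝ) ∧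
      Tendsto Uk atTop (𝓝 U) ∧
      G xbar = U * Matrix.diagonal lam * Uᵀ ∧
      (∀ k, Ω k = Uk k * Matrix.diagonal (om k) * (Uk k)ᵀ) ∧
      ∀ j, 0 < lam j → ∃ kj, ∀ k ≥ kj, om k j = 0

/-- `(xᵏ, μᵏ, Ωₖ)` is a CAKKT sequence corresponding to `x̄`. -/
structure IsCAKKTSeq (f : EuclideanSpace ℝ (Fin n) → ℝ)
    (h : EuclideanSpace ℝ (Fin n) → EuclideanSpace ℝ (Fin p))
    (G : EuclideanSpace ℝ (Fin n) → Matrix (Fin m) (Fin m) ℝ)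
    (xbar : EuclideanSpace ℝ (Fin n))
    (x : ℕ → EuclideanSpace ℝ (Fin n)) (μ : ℕ → EuclideanSpace ℝ (Fin p))
    (Ω : ℕ → Matrix (Fin m) (Fin m) ℝ) : Prop where
  posSemidef : ∀ k, (Ω k).PosSemidef
  tendsto_x : Tendsto x atTop (𝓝 xbar)
  tendsto_gradient :
    Tendsto (fun k => gradient (fun y => lagrangian f h G y (μ k) (Ω k)) (x k)) atTop (𝓝 0)
  complementarity : Tendsto (fun k => jordan (G (x k)) (Ω k)) atTop (𝓝 0)

/-- The second-order part shared by AKKT2 and CAKKT2: `εₖ > 0`, `εₖ → 0`, and from some index `n̄`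
on, `dᵀ (∇²ₓₓ L(xᵏ, μᵏ, Ωₖ) + σ(xᵏ, Ωₖ)) d ≥ -εₖ ‖d‖²` for all `d ∈ S(xᵏ, x̄)`. It is required for
every admissible choice of the analytic map `𝒰`; one exists by `exists_kernelFrame` and
`nonempty_kernelFrame`. -/
structure IsSecondOrderSeq (f : EuclideanSpace ℝ (Fin n) → ℝ)
    (h : EuclideanSpace ℝ (Fin n) → EuclideanSpace ℝ (Fin p))
    (G : EuclideanSpace ℝ (Fin n) → Matrix (Fin m) (Fin m) ℝ)
    (xbar : EuclideanSpace ℝ (Fin n))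
    (x : ℕ → EuclideanSpace ℝ (Fin n)) (μ : ℕ → EuclideanSpace ℝ (Fin p))
    (Ω : ℕ → Matrix (Fin m) (Fin m) ℝ) (ε : ℕ → ℝ) : Prop where
  eps_pos : ∀ k, 0 < ε k
  tendsto_eps : Tendsto ε atTop (𝓝 0)
  second_order : ∀ (b : ℕ) (U : KernelFrame (G xbar) b), ∃ nbar : ℕ, ∀ k ≥ nbar,
    G (x k) ∈ U.nhd ∧
    ∀ d ∈ criticalSubspace h G U (x k),
      d.ofLp ⬝ᵥ ((hessian (fun y => lagrangian f h G y (μ k) (Ω k)) (x k)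
        + sigmaTerm G (x k) (Ω k)) *ᵥ d.ofLp) ≥ -(ε k) * ‖d‖ ^ 2

/-- `x̄` satisfies AKKT2. -/
def IsAKKT2 (f : EuclideanSpace ℝ (Fin n) → ℝ)
    (h : EuclideanSpace ℝ (Fin n) → EuclideanSpace ℝ (Fin p))
    (G : EuclideanSpace ℝ (Fin n) → Matrix (Fin m) (Fin m) ℝ)
    (xbar : EuclideanSpace ℝ (Fin n)) : Prop :=
  xbar ∈ feasibleSet h G ∧ ∃ x μ Ω ε,
    IsAKKTSeq f h G xbar x μ Ω ∧ IsSecondOrderSeq f h G xbar x μ Ω ε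

/-- `x̄` satisfies CAKKT2. -/
def IsCAKKT2 (f : EuclideanSpace ℝ (Fin n) → ℝ)
    (h : EuclideanSpace ℝ (Fin n) → EuclideanSpace ℝ (Fin p))
    (G : EuclideanSpace ℝ (Fin n) → Matrix (Fin m) (Fin m) ℝ)
    (xbar : EuclideanSpace ℝ (Fin n)) : Prop :=
  xbar ∈ feasibleSet h G ∧ ∃ x μ Ω ε,
    IsCAKKTSeq f h G xbar x μ Ω ∧ IsSecondOrderSeq f h G xbar x μ Ω ε

end Problem

end NSDP

end

/-! The multipliers come from an external penalty. In a small closed ball around `xbar`, minimize `f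
y + ‖y - xbar‖ ^ 4 / 4 + r / 2 * (‖h y‖ ^ 2 + dist(G y, PSD) ^ 2)` with `r → ∞`. The minimizers `x
k` tend to `xbar` and become interior, and `r` times the penalty tends to `0`. The multipliers are
`μ = -r h(x)` and `Ω = r G(x)₋`, where `A = A₊ - A₋` is the spectral splitting and `‖A₋‖ = dist(A,
PSD)`. The exponent 4 matters: the gradient and the Hessian of the proximal term both vanish as `x k
→ xbar`, so neither disturbs the limit conditions.

The obstacle is that `dist ^ 2` need not be twice differentiable. It is replaced by a smooth
majorant with a slack matrix: `dist(G y, PSD) ^ 2 ≤ ‖G y - Z‖ ^ 2` for every positive semidefinite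
`Z`, with equality at `y = x`, `Z = G(x)₊`. Expanding the squares around that point turns minimality
into an inequality for the Lagrangian, jointly in `y` and `Z` (`penalized_inequality`). Freezing `Z
= G(x)₊` gives the gradient condition (`gradient_eq_of_penalized`).

For the second-order condition, `Z` moves with `y = x + t d` along the congruence curve `(1 + t B)ᵀ
G(x)₊ (1 + t B)`, which stays positive semidefinite. If its velocity is `DG(x)[d]`, the squared
mismatch is `o(t ^ 2)`, and the acceleration paired with `Ω` is what remains
(`second_order_of_penalized`). Such a `B` exists exactly because `d` lies in the perturbed critical
subspace: `DG(x)[d]` has no block on the small eigenvectors, so the equation for `B` can be solved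
by dividing by large positive eigenvalues only. The acceleration term then equals the sigma-term
(`exists_congruence_direction`).

One sequence serves both conclusions. For CAKKT, the Jordan product of `G(x)` and `Ω` is `-r G(x)₋ ^
2`, which tends to `0`. For AKKT, `Ω` shares the eigenvectors of `G(x)`, which converge along a
subsequence by compactness of the orthogonal group. -/

noncomputable section

namespace NSDP

/-! ### Spectral calculus and the positive and negative parts of a symmetric matrix. -/

section SpectralCalculus

variable {m : ℕ}

theorem conj_mul_conj {V : Matrix (Fin m) (Fin m) ℝ}
    (hV : V ∈ Matrix.orthogonalGroup (Fin m) ℝ) (A B : Matrix (Fin m) (Fin m) ℝ) :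
    V * A * Vᵀ * (V * B * Vᵀ) = V * (A * B) * Vᵀ := by
  have h1 : Vᵀ * V = 1 := (Matrix.mem_orthogonalGroup_iff' (Fin m) ℝ).mp hV
  simp only [Matrix.mul_assoc]
  rw [← Matrix.mul_assoc Vᵀ V, h1, Matrix.one_mul]

theorem conj_conj_cancel {V : Matrix (Fin m) (Fin m) ℝ}
    (hV : V ∈ Matrix.orthogonalGroup (Fin m) ℝ) (A : Matrix (Fin m) (Fin m) ℝ) :
    V * (Vᵀ * A * V) * Vᵀ = A := by
  have h1 : V * Vᵀ = 1 := (Matrix.mem_orthogonalGroup_iff (Fin m) ℝ).mp hV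
  calc V * (Vᵀ * A * V) * Vᵀ = (V * Vᵀ) * A * (V * Vᵀ) := by simp only [Matrix.mul_assoc]
    _ = A := by rw [h1, Matrix.one_mul, Matrix.mul_one]

theorem conj_transpose_conj_cancel {V : Matrix (Fin m) (Fin m) ℝ}
    (hV : V ∈ Matrix.orthogonalGroup (Fin m) ℝ) (A : Matrix (Fin m) (Fin m) ℝ) :
    Vᵀ * (V * A * Vᵀ) * V = A := by
  have h1 : Vᵀ * V = 1 := (Matrix.mem_orthogonalGroup_iff' (Fin m) ℝ).mp hV
  calc Vᵀ * (V * A * Vᵀ) * V = (Vᵀ * V) * A * (Vᵀ * V) := by simp only [Matrix.mul_assoc]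
    _ = A := by rw [h1, Matrix.one_mul, Matrix.mul_one]

theorem transpose_conj (V A : Matrix (Fin m) (Fin m) ℝ) : (V * A * Vᵀ)ᵀ = V * Aᵀ * Vᵀ := by
  simp only [Matrix.transpose_mul, Matrix.transpose_transpose, Matrix.mul_assoc]

theorem conj_add (V A B : Matrix (Fin m) (Fin m) ℝ) :
    V * (A + B) * Vᵀ = V * A * Vᵀ + V * B * Vᵀ := by
  rw [Matrix.mul_add, Matrix.add_mul]

theorem conj_sub (V A B : Matrix (Fin m) (Fin m) ℝ) :
    V * (A - B) * Vᵀ = V * A * Vᵀ - V * B * Vᵀ := by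
  rw [Matrix.mul_sub, Matrix.sub_mul]

theorem matInner_conj {V : Matrix (Fin m) (Fin m) ℝ}
    (hV : V ∈ Matrix.orthogonalGroup (Fin m) ℝ) (A B : Matrix (Fin m) (Fin m) ℝ) :
    matInner (V * A * Vᵀ) (V * B * Vᵀ) = matInner A B := by
  have h1 : Vᵀ * V = 1 := (Matrix.mem_orthogonalGroup_iff' (Fin m) ℝ).mp hV
  rw [matInner, transpose_conj, conj_mul_conj hV, Matrix.trace_mul_comm, ← Matrix.mul_assoc, h1,
    Matrix.one_mul, matInner]

/-- Functional calculus of symmetric matrices: `V diag(λ) Vᵀ ↦ V diag(φ ∘ λ) Vᵀ`. -/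
def spectralMap (φ : ℝ → ℝ) (A : Matrix (Fin m) (Fin m) ℝ) : Matrix (Fin m) (Fin m) ℝ :=
  open Classical in
  if h : ∃ q : Matrix (Fin m) (Fin m) ℝ × (Fin m → ℝ),
      q.1 ∈ Matrix.orthogonalGroup (Fin m) ℝ ∧ A = q.1 * Matrix.diagonal q.2 * q.1ᵀ then
    h.choose.1 * Matrix.diagonal (φ ∘ h.choose.2) * h.choose.1ᵀ
  else 0

/-- The matrix `Wᵀ * V` intertwines the two diagonal matrices, so each nonzero entry `(i, j)` forces
`v j = w i`, hence `φ (v j) = φ (w i)`. The intertwining therefore survives `φ`, which makes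
`spectralMap` independent of the chosen diagonalization, repeated eigenvalues included. -/
theorem diagonalization_congr (φ : ℝ → ℝ) {V W : Matrix (Fin m) (Fin m) ℝ}
    (hV : V ∈ Matrix.orthogonalGroup (Fin m) ℝ) (hW : W ∈ Matrix.orthogonalGroup (Fin m) ℝ)
    {v w : Fin m → ℝ} (h : V * Matrix.diagonal v * Vᵀ = W * Matrix.diagonal w * Wᵀ) :
    V * Matrix.diagonal (φ ∘ v) * Vᵀ = W * Matrix.diagonal (φ ∘ w) * Wᵀ := by
  have hV1 : Vᵀ * V = 1 := (Matrix.mem_orthogonalGroup_iff' (Fin m) ℝ).mp hV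
  have hV2 : V * Vᵀ = 1 := (Matrix.mem_orthogonalGroup_iff (Fin m) ℝ).mp hV
  have hW1 : Wᵀ * W = 1 := (Matrix.mem_orthogonalGroup_iff' (Fin m) ℝ).mp hW
  have hW2 : W * Wᵀ = 1 := (Matrix.mem_orthogonalGroup_iff (Fin m) ℝ).mp hW
  have key : (Wᵀ * V) * Matrix.diagonal v = Matrix.diagonal w * (Wᵀ * V) := by
    calc (Wᵀ * V) * Matrix.diagonal v = Wᵀ * (V * Matrix.diagonal v * Vᵀ) * V := by
          simp only [Matrix.mul_assoc]; rw [hV1, Matrix.mul_one]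
      _ = (Wᵀ * W) * Matrix.diagonal w * (Wᵀ * V) := by
          rw [h]; simp only [Matrix.mul_assoc]
      _ = _ := by rw [hW1, Matrix.one_mul]
  have key' : (Wᵀ * V) * Matrix.diagonal (φ ∘ v) = Matrix.diagonal (φ ∘ w) * (Wᵀ * V) := by
    ext i j
    have hij := congrFun (congrFun key i) j
    rw [Matrix.mul_diagonal, Matrix.diagonal_mul] at hij ⊢
    by_cases h0 : (Wᵀ * V) i j = 0
    · rw [h0, zero_mul, mul_zero]
    · rw [mul_comm] at hij
      rw [Function.comp_apply, Function.comp_apply, mul_right_cancel₀ h0 hij, mul_comm]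
  calc V * Matrix.diagonal (φ ∘ v) * Vᵀ
      = W * ((Wᵀ * V) * Matrix.diagonal (φ ∘ v)) * Vᵀ := by
        simp only [← Matrix.mul_assoc]; rw [hW2, Matrix.one_mul]
    _ = W * Matrix.diagonal (φ ∘ w) * Wᵀ * (V * Vᵀ) := by
        rw [key']; simp only [Matrix.mul_assoc]
    _ = _ := by rw [hV2, Matrix.mul_one]

theorem spectralMap_diagonalization (φ : ℝ → ℝ) {V : Matrix (Fin m) (Fin m) ℝ}
    (hV : V ∈ Matrix.orthogonalGroup (Fin m) ℝ) (lam : Fin m → ℝ) :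
    spectralMap φ (V * Matrix.diagonal lam * Vᵀ) = V * Matrix.diagonal (φ ∘ lam) * Vᵀ := by
  have h : ∃ q : Matrix (Fin m) (Fin m) ℝ × (Fin m → ℝ),
      q.1 ∈ Matrix.orthogonalGroup (Fin m) ℝ ∧
      V * Matrix.diagonal lam * Vᵀ = q.1 * Matrix.diagonal q.2 * q.1ᵀ := ⟨(V, lam), hV, rfl⟩
  rw [spectralMap, dif_pos h]
  exact diagonalization_congr φ h.choose_spec.1 hV h.choose_spec.2.symm

/-- The positive part of a symmetric matrix. -/
def matPos (A : Matrix (Fin m) (Fin m) ℝ) : Matrix (Fin m) (Fin m) ℝ :=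
  spectralMap (fun t => max t 0) A

/-- The negative part of a symmetric matrix. -/
def matNeg (A : Matrix (Fin m) (Fin m) ℝ) : Matrix (Fin m) (Fin m) ℝ :=
  spectralMap (fun t => max (-t) 0) A

theorem posSemidef_diagonalization (V : Matrix (Fin m) (Fin m) ℝ) {lam : Fin m → ℝ}
    (h : ∀ i, 0 ≤ lam i) : (V * Matrix.diagonal lam * Vᵀ).PosSemidef := by
  have := (Matrix.PosSemidef.diagonal (R := ℝ) (d := lam) h).mul_mul_conjTranspose_same V
  rwa [Matrix.conjTranspose_eq_transpose_of_trivial] at this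

theorem posSemidef_matPos {A : Matrix (Fin m) (Fin m) ℝ} (hA : A.IsSymm) :
    (matPos A).PosSemidef := by
  obtain ⟨V, hV, lam, -, rfl⟩ := exists_sorted_diagonalization hA
  rw [matPos, spectralMap_diagonalization _ hV]
  exact posSemidef_diagonalization V fun i => le_max_right _ _

theorem posSemidef_matNeg {A : Matrix (Fin m) (Fin m) ℝ} (hA : A.IsSymm) :
    (matNeg A).PosSemidef := by
  obtain ⟨V, hV, lam, -, rfl⟩ := exists_sorted_diagonalization hA
  rw [matNeg, spectralMap_diagonalization _ hV]
  exact posSemidef_diagonalization V fun i => le_max_right _ _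

theorem max_sub_max_neg (t : ℝ) : max t 0 - max (-t) 0 = t := by
  rcases le_total 0 t with h | h
  · rw [max_eq_left h, max_eq_right (by linarith), sub_zero]
  · rw [max_eq_right h, max_eq_left (by linarith), zero_sub, neg_neg]

theorem max_mul_max_neg (t : ℝ) : max t 0 * max (-t) 0 = 0 := by
  rcases le_total 0 t with h | h
  · rw [max_eq_right (show -t ≤ 0 by linarith), mul_zero]
  · rw [max_eq_right h, zero_mul]

theorem matPos_sub_matNeg {A : Matrix (Fin m) (Fin m) ℝ} (hA : A.IsSymm) :
    matPos A - matNeg A = A := by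
  obtain ⟨V, hV, lam, -, rfl⟩ := exists_sorted_diagonalization hA
  rw [matPos, matNeg, spectralMap_diagonalization _ hV, spectralMap_diagonalization _ hV,
    ← conj_sub, Matrix.diagonal_sub]
  congr 3
  funext i
  exact max_sub_max_neg _

theorem matPos_mul_matNeg {A : Matrix (Fin m) (Fin m) ℝ} (hA : A.IsSymm) :
    matPos A * matNeg A = 0 := by
  obtain ⟨V, hV, lam, -, rfl⟩ := exists_sorted_diagonalization hA
  rw [matPos, matNeg, spectralMap_diagonalization _ hV, spectralMap_diagonalization _ hV,
    conj_mul_conj hV, Matrix.diagonal_mul_diagonal]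
  have : (fun i => ((fun t => max t 0) ∘ lam) i * ((fun t => max (-t) 0) ∘ lam) i) = 0 := by
    funext i
    exact max_mul_max_neg _
  rw [this]
  simp

theorem _root_.Matrix.PosSemidef.isSymm {A : Matrix (Fin m) (Fin m) ℝ} (hA : A.PosSemidef) :
    A.IsSymm := by
  have := hA.isHermitian
  rwa [Matrix.IsHermitian, Matrix.conjTranspose_eq_transpose_of_trivial] at this

theorem matNeg_mul_matPos {A : Matrix (Fin m) (Fin m) ℝ} (hA : A.IsSymm) :
    matNeg A * matPos A = 0 := by
  have := congrArg Matrix.transpose (matPos_mul_matNeg hA)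
  rwa [Matrix.transpose_mul, (posSemidef_matNeg hA).isSymm.eq, (posSemidef_matPos hA).isSymm.eq,
    Matrix.transpose_zero] at this

/-- The two parts annihilate each other, so both products of `A` with its negative part reduce to
minus the square. This is the source of CAKKT complementarity. -/
theorem jordan_matNeg {A : Matrix (Fin m) (Fin m) ℝ} (hA : A.IsSymm) (r : ℝ) :
    jordan A (r • matNeg A) = -(r • (matNeg A * matNeg A)) := by
  have h1 : A * matNeg A = -(matNeg A * matNeg A) := by
    conv_lhs => rw [← matPos_sub_matNeg hA, Matrix.sub_mul]
    rw [matPos_sub_matNeg hA, matPos_mul_matNeg hA, zero_sub]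
  have h2 : matNeg A * A = -(matNeg A * matNeg A) := by
    conv_lhs => rw [← matPos_sub_matNeg hA, Matrix.mul_sub]
    rw [matPos_sub_matNeg hA, matNeg_mul_matPos hA, zero_sub]
  rw [jordan, Matrix.mul_smul, Matrix.smul_mul, h1, h2]
  module

/-! ### The trace inner product and the projection onto the positive semidefinite cone. -/

theorem matInner_eq_sum (A B : Matrix (Fin m) (Fin m) ℝ) :
    matInner A B = ∑ i, ∑ j, A i j * B i j := by
  rw [matInner, Matrix.trace, Finset.sum_comm]
  rfl

theorem matInner_comm (A B : Matrix (Fin m) (Fin m) ℝ) : matInner A B = matInner B A := by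
  simp only [matInner_eq_sum, mul_comm]

theorem frobenius_norm_sq (A : Matrix (Fin m) (Fin m) ℝ) : ‖A‖ ^ 2 = matInner A A := by
  rw [Matrix.frobenius_norm_def, ← Real.sqrt_eq_rpow, Real.sq_sqrt (by positivity),
    matInner_eq_sum]
  refine Finset.sum_congr rfl fun i _ => Finset.sum_congr rfl fun j _ => ?_
  exact (Real.rpow_two _).trans ((sq_abs (A i j)).trans (pow_two _))

theorem matInner_add_left (A B C : Matrix (Fin m) (Fin m) ℝ) :
    matInner (A + B) C = matInner A C + matInner B C := by
  simp [matInner, Matrix.add_mul]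

theorem matInner_add_right (A B C : Matrix (Fin m) (Fin m) ℝ) :
    matInner A (B + C) = matInner A B + matInner A C := by
  simp [matInner, Matrix.mul_add]

theorem matInner_sub_left (A B C : Matrix (Fin m) (Fin m) ℝ) :
    matInner (A - B) C = matInner A C - matInner B C := by
  simp [matInner, Matrix.sub_mul]

theorem matInner_sub_right (A B C : Matrix (Fin m) (Fin m) ℝ) :
    matInner A (B - C) = matInner A B - matInner A C := by
  simp [matInner, Matrix.mul_sub]

theorem matInner_smul_left (r : ℝ) (A B : Matrix (Fin m) (Fin m) ℝ) :
    matInner (r • A) B = r * matInner A B := by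
  simp [matInner]

theorem matInner_smul_right (r : ℝ) (A B : Matrix (Fin m) (Fin m) ℝ) :
    matInner A (r • B) = r * matInner A B := by
  simp [matInner]

/-- In an eigenbasis of `A` the pairing is the sum of the eigenvalues of `A` times the diagonal
entries of the rotated `B`, all nonnegative. -/
theorem matInner_nonneg {A B : Matrix (Fin m) (Fin m) ℝ} (hA : A.PosSemidef)
    (hB : B.PosSemidef) : 0 ≤ matInner A B := by
  obtain ⟨V, hV, lam, -, hdec⟩ := exists_sorted_diagonalization hA.isSymm
  have hl : ∀ i, 0 ≤ lam i := by
    have h1 := hA.conjTranspose_mul_mul_same V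
    rw [Matrix.conjTranspose_eq_transpose_of_trivial, hdec, conj_transpose_conj_cancel hV] at h1
    exact Matrix.posSemidef_diagonal_iff.mp h1
  have h2 := hB.conjTranspose_mul_mul_same V
  rw [Matrix.conjTranspose_eq_transpose_of_trivial] at h2
  rw [hdec, ← conj_conj_cancel hV B, matInner_conj hV, matInner, Matrix.diagonal_transpose,
    Matrix.trace]
  refine Finset.sum_nonneg fun i _ => ?_
  rw [Matrix.diag_apply, Matrix.diagonal_mul]
  exact mul_nonneg (hl i) (h2.diag_nonneg)

/-- The positive part of a symmetric matrix is its nearest positive semidefinite matrix. -/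
theorem norm_matNeg_le {A Z : Matrix (Fin m) (Fin m) ℝ} (hA : A.IsSymm) (hZ : Z.PosSemidef) :
    ‖matNeg A‖ ≤ ‖A - Z‖ := by
  refine le_of_sq_le_sq ?_ (norm_nonneg _)
  have h1 : A - Z = (matPos A - Z) - matNeg A := by
    conv_lhs => rw [← matPos_sub_matNeg hA]
    abel
  have h2 : matInner (matPos A) (matNeg A) = 0 := by
    rw [matInner, (posSemidef_matPos hA).isSymm.eq, matPos_mul_matNeg hA, Matrix.trace_zero]
  -- After expanding the square, the cross term is `-2 ⟨A₊ - Z, A₋⟩ = 2 ⟨Z, A₋⟩ ≥ 0`.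
  have h3 := matInner_nonneg hZ (posSemidef_matNeg hA)
  have h4 := frobenius_norm_sq (matPos A - Z)
  have h5 := sq_nonneg ‖matPos A - Z‖
  rw [h1, frobenius_norm_sq, frobenius_norm_sq, matInner_sub_left _ (matNeg A),
    matInner_sub_right _ _ (matNeg A), matInner_sub_right _ _ (matNeg A),
    matInner_comm (matNeg A) (matPos A - Z), matInner_sub_left _ _ (matNeg A), h2]
  linarith

theorem infDist_posSemidef {A : Matrix (Fin m) (Fin m) ℝ} (hA : A.IsSymm) :
    Metric.infDist A {Z | Z.PosSemidef} = ‖matNeg A‖ := by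
  have hmem : matPos A ∈ {Z : Matrix (Fin m) (Fin m) ℝ | Z.PosSemidef} := posSemidef_matPos hA
  refine le_antisymm ?_ ?_
  · refine (Metric.infDist_le_dist_of_mem hmem).trans ?_
    rw [dist_comm, dist_eq_norm, sub_eq_of_eq_add' (sub_eq_iff_eq_add.mp (matPos_sub_matNeg hA))]
  · refine (Metric.le_infDist ⟨_, hmem⟩).mpr fun Z hZ => ?_
    rw [dist_eq_norm]
    exact norm_matNeg_le hA hZ

theorem posSemidef_of_matNeg_eq_zero {A : Matrix (Fin m) (Fin m) ℝ} (hA : A.IsSymm)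
    (h : matNeg A = 0) : A.PosSemidef := by
  have := matPos_sub_matNeg hA
  rw [h, sub_zero] at this
  rw [← this]
  exact posSemidef_matPos hA

/-! ### The congruence direction and the sigma-term. -/

theorem pinv_diagonalization {V : Matrix (Fin m) (Fin m) ℝ}
    (hV : V ∈ Matrix.orthogonalGroup (Fin m) ℝ) (lam : Fin m → ℝ) :
    pinv (V * Matrix.diagonal lam * Vᵀ) = V * Matrix.diagonal (fun i => (lam i)⁻¹) * Vᵀ := by
  refine (isPseudoinverse_pinv ?_).unique (isPseudoinverse_diagonalization hV lam)
  rw [Matrix.IsSymm, transpose_conj, Matrix.diagonal_transpose]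

/-- If the symmetric matrix `D` vanishes on the span of the eigenvectors of `A` outside a set `q`
of eigenvectors with positive eigenvalues, then there is a congruence curve through the positive
part of `A` with velocity `D` whose acceleration, tested against the negative part, is the
sigma-term. -/
theorem exists_congruence_direction {A D V : Matrix (Fin m) (Fin m) ℝ} {lam : Fin m → ℝ}
    (hV : V ∈ Matrix.orthogonalGroup (Fin m) ℝ) (hA : A = V * Matrix.diagonal lam * Vᵀ)
    (hD : D.IsSymm) (q : Set (Fin m)) (hq : ∀ j ∈ q, 0 < lam j)
    (hz : ∀ i ∉ q, ∀ j ∉ q, (Vᵀ * D * V) i j = 0) :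
    ∃ E : Matrix (Fin m) (Fin m) ℝ, Eᵀ * matPos A + matPos A * E = D ∧
      matInner (matNeg A) D = 0 ∧
      matInner (matNeg A) (Eᵀ * matPos A * E) = matInner (matNeg A) (D * pinv A * D) := by
  classical
  set D' := Vᵀ * D * V with hD'
  have hDV : D = V * D' * Vᵀ := (conj_conj_cancel hV D).symm
  have hsymm : ∀ i j, D' j i = D' i j := by
    intro i j
    have : D'ᵀ = D' := by
      rw [hD', Matrix.transpose_mul, Matrix.transpose_mul, Matrix.transpose_transpose, hD.eq,
        Matrix.mul_assoc]
    exact congrFun (congrFun this i) j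
  let c : Fin m → ℝ := fun i => if i ∈ q then 1 else 0
  -- In the eigenbasis the equation reads `E' j i * pl j + pl i * E' i j = D' i j`. If both indices
  -- lie in `q`, each summand supplies half of the entry. If exactly one does, its summand supplies
  -- all of it. If neither does, the entry is zero by `hz`. The factor `1 - c j / 2` encodes this
  -- split, and only eigenvalues indexed by `q` are inverted.
  let E' : Matrix (Fin m) (Fin m) ℝ :=
    Matrix.of fun i j => c i * (lam i)⁻¹ * D' i j * (1 - c j / 2)
  let pl : Fin m → ℝ := (fun t => max t 0) ∘ lam
  let om : Fin m → ℝ := (fun t => max (-t) 0) ∘ lam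
  have hpl : matPos A = V * Matrix.diagonal pl * Vᵀ := by
    rw [matPos, hA, spectralMap_diagonalization _ hV]
  have hom : matNeg A = V * Matrix.diagonal om * Vᵀ := by
    rw [matNeg, hA, spectralMap_diagonalization _ hV]
  have hplc : ∀ i, pl i * (c i * (lam i)⁻¹) = c i := by
    intro i
    by_cases hi : i ∈ q
    · have := hq i hi
      simp [pl, c, hi, max_eq_left this.le, this.ne']
    · simp [c, hi]
  have homc : ∀ i, i ∈ q → om i = 0 := by
    intro i hi
    have := hq i hi
    simp only [om, Function.comp]
    exact max_eq_right (by linarith)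
  have hin : ∀ B : Matrix (Fin m) (Fin m) ℝ,
      matInner (Matrix.diagonal om) B = ∑ i, om i * B i i := by
    intro B
    rw [matInner, Matrix.diagonal_transpose, Matrix.trace]
    exact Finset.sum_congr rfl fun i _ => by rw [Matrix.diag_apply, Matrix.diagonal_mul]
  refine ⟨V * E' * Vᵀ, ?_, ?_, ?_⟩
  · rw [hpl, transpose_conj, conj_mul_conj hV, conj_mul_conj hV, ← conj_add, hDV]
    congr 2
    ext i j
    rw [Matrix.add_apply, Matrix.mul_diagonal, Matrix.diagonal_mul, Matrix.transpose_apply]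
    have e1 : E' j i * pl j = c j * D' i j * (1 - c i / 2) := by
      rw [← hsymm, ← hplc j]; simp only [E', Matrix.of_apply]
      rw [hplc]; linear_combination (D' j i * (1 - c i / 2)) * hplc j
    have e2 : pl i * E' i j = c i * D' i j * (1 - c j / 2) := by
      simp only [E', Matrix.of_apply]
      linear_combination (D' i j * (1 - c j / 2)) * hplc i
    rw [e1, e2]
    by_cases hi : i ∈ q <;> by_cases hj : j ∈ q <;> simp [c, hi, hj]
    · ring
    · exact (hz i hi j hj).symm
  · rw [hom, hDV, matInner_conj hV, hin]
    refine Finset.sum_eq_zero fun i _ => ?_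
    by_cases hi : i ∈ q
    · rw [homc i hi, zero_mul]
    · rw [hz i hi i hi, mul_zero]
  · rw [hpl, hom, transpose_conj, conj_mul_conj hV, conj_mul_conj hV, matInner_conj hV, hA,
      pinv_diagonalization hV, hDV, conj_mul_conj hV, conj_mul_conj hV, matInner_conj hV, hin, hin]
    refine Finset.sum_congr rfl fun i _ => ?_
    -- The negative part sees only diagonal entries with `i ∉ q`. There `E' j i = D' j i / lam j`
    -- for `j ∈ q`, without the factor one half, so the sum is that of `D' diag(lam⁻¹) D'`.
    by_cases hi : i ∈ q
    · rw [homc i hi, zero_mul, zero_mul]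
    · congr 1
      rw [Matrix.mul_apply, Matrix.mul_apply]
      refine Finset.sum_congr rfl fun j _ => ?_
      rw [Matrix.mul_diagonal, Matrix.mul_diagonal, Matrix.transpose_apply]
      by_cases hj : j ∈ q
      · have := hq j hj
        simp only [E', Matrix.of_apply, c, hi, hj, if_true, if_false, pl, Function.comp,
          max_eq_left this.le, hsymm i j]
        field_simp
        ring
      -- Zero or negative eigenvalues outside `q` enter the pseudoinverse only against vanishing
      -- entries of `D'`.
      · rw [hz i hi j hj]
        simp [E', c, hj]

/-- For a frame of the smallest eigenvectors: the first eigenvectors are orthogonal to it and the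
last ones lie in its span. -/
theorem exists_congruence_direction_of_frame {b : ℕ} {A D V : Matrix (Fin m) (Fin m) ℝ}
    {W : Matrix (Fin m) (Fin b) ℝ} {lam : Fin m → ℝ}
    (hV : V ∈ Matrix.orthogonalGroup (Fin m) ℝ) (hA : A = V * Matrix.diagonal lam * Vᵀ)
    (hspan : Submodule.span ℝ (Set.range W.col) =
      Submodule.span ℝ (V.col '' {j | m ≤ (j : ℕ) + b}))
    {c : ℝ} (hc : 0 < c) (hpos : ∀ v : Fin m → ℝ, c * (v ⬝ᵥ v) ≤ v ⬝ᵥ ((A + W * Wᵀ) *ᵥ v))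
    (hD : D.IsSymm) (hz : Wᵀ * D * W = 0) :
    ∃ E : Matrix (Fin m) (Fin m) ℝ, Eᵀ * matPos A + matPos A * E = D ∧
      matInner (matNeg A) D = 0 ∧
      matInner (matNeg A) (Eᵀ * matPos A * E) = matInner (matNeg A) (D * pinv A * D) := by
  have hVV : Vᵀ * V = 1 := (Matrix.mem_orthogonalGroup_iff' (Fin m) ℝ).mp hV
  have horth : ∀ i j, V.col i ⬝ᵥ V.col j = (1 : Matrix (Fin m) (Fin m) ℝ) i j := by
    intro i j
    rw [← hVV]
    rfl
  refine exists_congruence_direction hV hA hD {j | ¬ m ≤ (j : ℕ) + b} (fun j hj => ?_)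
    (fun i hi j hj => ?_)
  · have hW0 : Wᵀ *ᵥ V.col j = 0 := by
      funext l
      have hl : W.col l ∈ Submodule.span ℝ (V.col '' {j | m ≤ (j : ℕ) + b}) := by
        rw [← hspan]; exact Submodule.subset_span ⟨l, rfl⟩
      have hle : Submodule.span ℝ (V.col '' {j | m ≤ (j : ℕ) + b}) ≤
          LinearMap.ker (dotProductBilin ℝ ℝ (V.col j)) := by
        rw [Submodule.span_le]
        rintro _ ⟨i, hi, rfl⟩
        have hij : j ≠ i := by rintro rfl; exact hj hi
        rw [SetLike.mem_coe, LinearMap.mem_ker]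
        exact (horth j i).trans (Matrix.one_apply_ne hij)
      have := LinearMap.mem_ker.mp (hle hl)
      rw [Pi.zero_apply, ← this]
      exact dotProduct_comm (W.col l) (V.col j)
    have heig : A *ᵥ V.col j = lam j • V.col j := by
      have h0 : A * V = V * Matrix.diagonal lam := by
        rw [hA, Matrix.mul_assoc, hVV, Matrix.mul_one]
      funext i
      have := congrFun (congrFun h0 i) j
      rw [Matrix.mul_diagonal] at this
      rw [Pi.smul_apply, smul_eq_mul, mul_comm]
      exact this
    -- Since this eigenvector is orthogonal to the frame, the `W * Wᵀ` term drops out and the bound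
    -- reads `c ≤ lam j`.
    have h := hpos (V.col j)
    rw [Matrix.add_mulVec, ← Matrix.mulVec_mulVec, hW0, Matrix.mulVec_zero, add_zero, heig,
      dotProduct_smul, horth, Matrix.one_apply_eq, smul_eq_mul] at h
    linarith
  · have hmem : ∀ i : Fin m, i ∉ {j : Fin m | ¬ m ≤ (j : ℕ) + b} → ∃ y, W *ᵥ y = V.col i := by
      intro i hi
      have : V.col i ∈ Submodule.span ℝ (Set.range W.col) := by
        rw [hspan]; exact Submodule.subset_span ⟨i, not_not.mp hi, rfl⟩
      rw [← Matrix.range_mulVecLin] at this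
      exact this
    obtain ⟨y, hy⟩ := hmem i hi
    obtain ⟨z, hz'⟩ := hmem j hj
    have : (Vᵀ * D * V) i j = V.col i ⬝ᵥ (D *ᵥ V.col j) := by
      rw [Matrix.mul_assoc]
      rfl
    rw [this, ← hy, ← hz', Matrix.dotProduct_mulVec, Matrix.vecMul_mulVec,
      ← Matrix.dotProduct_mulVec, Matrix.mulVec_mulVec, hz, Matrix.zero_mulVec, dotProduct_zero]

end SpectralCalculus

/-! ### Optimality conditions for the penalized problem. -/

section SecondOrder

open Asymptotics

/-- Adding the Taylor expansions at `t` and `-t` cancels the odd term, so the second-order argument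
needs no information on first derivatives of the Lagrangian. -/
theorem second_symmetric_difference {g g' : ℝ → ℝ} {g'' : ℝ} (hg : ContDiff ℝ 2 g)
    (h1 : ∀ t, HasDerivAt g (g' t) t) (h2 : HasDerivAt g' g'' 0) :
    (fun t => g t + g (-t) - 2 * g 0 - t ^ 2 * g'') =o[𝓝 0] fun t => t ^ 2 := by
  have hT := taylor_isLittleO (f := g) (x₀ := 0) (n := 2) convex_univ (mem_univ _)
    (by exact_mod_cast hg.contDiffOn)
  have e1 : deriv g = g' := funext fun t => (h1 t).deriv
  have hTay : ∀ t, taylorWithinEval g 2 univ 0 t = g 0 + t * g' 0 + t ^ 2 / 2 * g'' := by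
    intro t
    rw [taylorWithinEval_succ, taylorWithinEval_succ, taylor_within_zero_eval,
      iteratedDerivWithin_univ, iteratedDerivWithin_univ, iteratedDeriv_one, iteratedDeriv_succ,
      iteratedDeriv_one, e1, h2.deriv]
    norm_num
    exact Or.inl (by ring)
  simp only [hTay, sub_zero, nhdsWithin_univ] at hT
  have hn : Tendsto (fun t : ℝ => -t) (𝓝 0) (𝓝 0) := by
    simpa using (continuous_neg (G := ℝ)).tendsto 0
  have hT' := hT.comp_tendsto hn
  have hT'' : (fun t => g (-t) - (g 0 + -t * g' 0 + (-t) ^ 2 / 2 * g'')) =o[𝓝 0]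
      fun t : ℝ => t ^ 2 := by
    refine hT'.congr (fun t => rfl) (fun t => ?_)
    simp [Function.comp]
  refine (hT.add hT'').congr_left fun t => ?_
  ring

theorem nonneg_of_eventually_nonneg_add_isLittleO {c : ℝ} {r : ℝ → ℝ}
    (h : ∀ᶠ t in 𝓝 (0 : ℝ), 0 ≤ t ^ 2 * c + r t) (hr : r =o[𝓝 0] fun t => t ^ 2) : 0 ≤ c := by
  by_contra hc
  have hb := hr.bound (show 0 < -c / 2 by linarith)
  obtain ⟨t, ⟨ht1, ht2⟩, ht0⟩ :=
    (((h.and hb).filter_mono nhdsWithin_le_nhds).and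
      (eventually_mem_nhdsWithin (s := {(0 : ℝ)}ᶜ))).exists
  have ht : 0 < t ^ 2 := by
    have : t ≠ 0 := ht0
    positivity
  rw [Real.norm_eq_abs, Real.norm_eq_abs, abs_of_pos ht] at ht2
  have := (abs_le.mp ht2).2
  nlinarith

/-- Makes a squared penalty increment negligible at second order along a curve of zero velocity,
whatever the fixed penalty parameter. -/
theorem norm_sq_sub_isLittleO {F : Type*} [NormedAddCommGroup F] [NormedSpace ℝ F] {k : ℝ → F}
    (hk : HasDerivAt k 0 0) : (fun t => ‖k t - k 0‖ ^ 2) =o[𝓝 0] fun t : ℝ => t ^ 2 := by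
  have h1 : (fun t => k t - k 0) =o[𝓝 0] fun t : ℝ => t := by
    simpa using hasDerivAt_iff_isLittleO.mp hk
  exact h1.norm_left.pow two_pos

/-- The square of an `O(‖y - x‖)` increment is `o(‖y - x‖)`; differentiability of the norm of `F`
plays no role. -/
theorem hasFDerivAt_norm_sq_sub {E F : Type*} [NormedAddCommGroup E] [NormedSpace ℝ E]
    [NormedAddCommGroup F] [NormedSpace ℝ F] {k : E → F} {x : E} (hk : DifferentiableAt ℝ k x) :
    HasFDerivAt (fun y => ‖k y - k x‖ ^ 2) (0 : E →L[ℝ] ℝ) x := by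
  rw [hasFDerivAt_iff_isLittleO]
  have h1 : (fun y => k y - k x) =O[𝓝 x] fun y => y - x := hk.hasFDerivAt.isBigO_sub
  have h2 : (fun y => ‖k y - k x‖ ^ 2) =O[𝓝 x] fun y => ‖y - x‖ ^ 2 := (h1.norm_norm).pow 2
  have h3 : (fun y => ‖y - x‖ ^ 2) =o[𝓝 x] fun y => y - x := by
    have h4 : Tendsto (fun y => y - x) (𝓝 x) (𝓝 0) := by
      have : Continuous fun y : E => y - x := by fun_prop
      simpa using this.tendsto x
    exact (isLittleO_norm_pow_id one_lt_two).comp_tendsto h4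
  simpa using h2.trans_isLittleO h3

variable {E F : Type*} [NormedAddCommGroup E] [InnerProductSpace ℝ E]
  [NormedAddCommGroup F] [NormedSpace ℝ F] {m : ℕ}

/-- The first-order condition for the penalized problem. -/
theorem gradient_eq_of_penalized [CompleteSpace E] {L : E → ℝ} {h : E → F}
    {G : E → Matrix (Fin m) (Fin m) ℝ} {x xbar : E} {Z₀ Ω : Matrix (Fin m) (Fin m) ℝ} {r : ℝ}
    (hL : DifferentiableAt ℝ L x) (hh : DifferentiableAt ℝ h x) (hG : DifferentiableAt ℝ G x)
    (hZ₀ : Z₀.PosSemidef)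
    (H : ∀ᶠ y in 𝓝 x, ∀ Z : Matrix (Fin m) (Fin m) ℝ, Z.PosSemidef →
      0 ≤ L y - L x + (‖y - xbar‖ ^ 4 - ‖x - xbar‖ ^ 4) / 4 + matInner Ω (Z - Z₀) +
        r / 2 * ‖h y - h x‖ ^ 2 + r / 2 * ‖G y - G x - (Z - Z₀)‖ ^ 2) :
    gradient L x = -(‖x - xbar‖ ^ 2 • (x - xbar)) := by
  -- The slack is frozen at `Z = Z₀`, which leaves a differentiable function of `y` whose two
  -- penalty increments have zero derivative at `x`.
  have hmin : IsLocalMin (fun y => L y + (1 / 4 : ℝ) * (‖y - xbar‖ ^ 2) ^ 2 +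
      r / 2 * ‖h y - h x‖ ^ 2 + r / 2 * ‖G y - G x‖ ^ 2) x := by
    filter_upwards [H] with y hy
    have := hy Z₀ hZ₀
    simp only [sub_self, sub_zero, norm_zero] at this ⊢
    have hi : matInner Ω 0 = 0 := by simp [matInner]
    rw [hi] at this
    ring_nf at this ⊢
    linarith
  have hq : HasFDerivAt (fun y : E => ‖y - xbar‖ ^ 2) (2 • (innerSL ℝ) (x - xbar)) x := by
    have := ((hasFDerivAt_id (𝕜 := ℝ) x).sub_const xbar).norm_sq
    simpa using this
  have hd := (((hL.hasFDerivAt.add ((hq.pow 2).const_mul (1 / 4 : ℝ))).add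
    ((hasFDerivAt_norm_sq_sub hh).const_mul (r / 2))).add
    ((hasFDerivAt_norm_sq_sub hG).const_mul (r / 2)))
  have h0 := hmin.hasFDerivAt_eq_zero hd
  refine HasGradientAt.gradient ?_
  rw [hasGradientAt_iff_hasFDerivAt]
  have : fderiv ℝ L x = InnerProductSpace.toDual ℝ E (-(‖x - xbar‖ ^ 2 • (x - xbar))) := by
    ext v
    have hv := congrArg (fun T : E →L[ℝ] ℝ => T v) h0
    simp at hv
    simp only [map_neg, map_smul, neg_apply, smul_apply,
      InnerProductSpace.toDual_apply_apply, smul_eq_mul, inner_sub_left]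
    linarith
  rw [← this]
  exact hL.hasFDerivAt

/-- The second-order condition for the penalized problem, along a congruence curve. -/
theorem second_order_of_penalized {L : E → ℝ} {h : E → F}
    {G : E → Matrix (Fin m) (Fin m) ℝ} {x xbar d : E} {Z₀ Ω B : Matrix (Fin m) (Fin m) ℝ} {r : ℝ}
    (hL : ContDiff ℝ 2 L) (hh : DifferentiableAt ℝ h x) (hG : DifferentiableAt ℝ G x)
    (hZ₀ : Z₀.PosSemidef)
    (H : ∀ᶠ y in 𝓝 x, ∀ Z : Matrix (Fin m) (Fin m) ℝ, Z.PosSemidef →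
      0 ≤ L y - L x + (‖y - xbar‖ ^ 4 - ‖x - xbar‖ ^ 4) / 4 + matInner Ω (Z - Z₀) +
        r / 2 * ‖h y - h x‖ ^ 2 + r / 2 * ‖G y - G x - (Z - Z₀)‖ ^ 2)
    (hdh : fderiv ℝ h x d = 0) (hdG : Bᵀ * Z₀ + Z₀ * B = fderiv ℝ G x d)
    (hΩ : matInner Ω (fderiv ℝ G x d) = 0) :
    0 ≤ fderiv ℝ (fderiv ℝ L) x d d + 2 * matInner Ω (Bᵀ * Z₀ * B) +
      3 * ‖x - xbar‖ ^ 2 * ‖d‖ ^ 2 := by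
  -- Congruence keeps the slack positive semidefinite for every real `t`, so both signs of `t` are
  -- admissible.
  let Z : ℝ → Matrix (Fin m) (Fin m) ℝ := fun t => (1 + t • B)ᵀ * Z₀ * (1 + t • B)
  have hZ : ∀ t, Z t - Z₀ = t • fderiv ℝ G x d + t ^ 2 • (Bᵀ * Z₀ * B) := by
    intro t
    simp only [Z, ← hdG, Matrix.transpose_add, Matrix.transpose_one, Matrix.transpose_smul,
      Matrix.add_mul, Matrix.mul_add, Matrix.one_mul, Matrix.mul_one, Matrix.smul_mul,
      Matrix.mul_smul]
    module
  have hZpos : ∀ t, (Z t).PosSemidef := by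
    intro t
    have := hZ₀.conjTranspose_mul_mul_same (1 + t • B)
    rwa [Matrix.conjTranspose_eq_transpose_of_trivial] at this
  have hline : ∀ t : ℝ, HasDerivAt (fun t : ℝ => x + t • d) d t := by
    intro t
    simpa using ((hasDerivAt_id t).smul_const d).const_add x
  have hline0 : x + (0 : ℝ) • d = x := by simp
  have hlinec : Tendsto (fun t : ℝ => x + t • d) (𝓝 0) (𝓝 x) := by
    simpa [hline0] using (hline 0).continuousAt.tendsto
  have hn : Tendsto (fun t : ℝ => -t) (𝓝 0) (𝓝 0) := by
    simpa using (continuous_neg (G := ℝ)).tendsto 0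
  -- remainders
  let r1 : ℝ → ℝ := fun t => ‖h (x + t • d) - h x‖ ^ 2
  let r2 : ℝ → ℝ := fun t => ‖G (x + t • d) - G x - (Z t - Z₀)‖ ^ 2
  have hr1 : r1 =o[𝓝 0] fun t => t ^ 2 := by
    have hk : HasDerivAt (fun t : ℝ => h (x + t • d)) 0 0 := by
      rw [← hdh]
      exact HasFDerivAt.comp_hasDerivAt (x := (0 : ℝ)) (f := fun t : ℝ => x + t • d) (l := h)
        (l' := fderiv ℝ h x) (by simpa using hh.hasFDerivAt) (hline 0)
    simpa [r1] using norm_sq_sub_isLittleO hk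
  have hr2 : r2 =o[𝓝 0] fun t => t ^ 2 := by
    have hk1 : HasDerivAt (fun t : ℝ => G (x + t • d)) (fderiv ℝ G x d) 0 :=
      HasFDerivAt.comp_hasDerivAt (x := (0 : ℝ)) (f := fun t : ℝ => x + t • d) (l := G)
        (l' := fderiv ℝ G x) (by rw [hline0]; exact hG.hasFDerivAt) (hline 0)
    have hk2 : HasDerivAt (fun t : ℝ => t • fderiv ℝ G x d + t ^ 2 • (Bᵀ * Z₀ * B))
        (fderiv ℝ G x d) 0 := by
      refine (((hasDerivAt_id (0 : ℝ)).smul_const _).add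
        ((hasDerivAt_pow 2 (0 : ℝ)).smul_const _)).congr_deriv ?_
      simp
    -- The velocities of `G (x + t • d)` and of the slack agree by the choice of `B`, so their
    -- mismatch is `o(t)`.
    have hk3 : HasDerivAt (fun t : ℝ => G (x + t • d) -
        (t • fderiv ℝ G x d + t ^ 2 • (Bᵀ * Z₀ * B))) 0 0 :=
      (hk1.sub hk2).congr_deriv (sub_self _)
    refine (norm_sq_sub_isLittleO hk3).congr_left fun t => ?_
    simp only [r2, hZ, hline0]
    congr 2
    module
  have hflip : ∀ {s : ℝ → ℝ}, s =o[𝓝 0] (fun t => t ^ 2) →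
      (fun t => s (-t)) =o[𝓝 0] fun t : ℝ => t ^ 2 := by
    intro s hs
    refine (hs.comp_tendsto hn).congr (fun t => rfl) (fun t => ?_)
    simp [Function.comp]
  have hr4 : (fun t : ℝ => t ^ 4 * (‖d‖ ^ 4 / 2)) =o[𝓝 0] fun t => t ^ 2 := by
    have : (fun t : ℝ => t ^ 4) =o[𝓝 0] fun t => t ^ 2 := isLittleO_pow_pow (by norm_num)
    simpa [mul_comm] using this.const_mul_left (‖d‖ ^ 4 / 2)
  -- the Taylor expansion of the Lagrangian
  have hg : ContDiff ℝ 2 (fun t : ℝ => L (x + t • d)) := by fun_prop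
  have hg1 : ∀ t : ℝ, HasDerivAt (fun t : ℝ => L (x + t • d)) (fderiv ℝ L (x + t • d) d) t :=
    fun t => HasFDerivAt.comp_hasDerivAt t
      ((hL.differentiable two_ne_zero _).hasFDerivAt) (hline t)
  have hg2 : HasDerivAt (fun t : ℝ => fderiv ℝ L (x + t • d) d)
      (fderiv ℝ (fderiv ℝ L) x d d) 0 := by
    have hd1 : DifferentiableAt ℝ (fderiv ℝ L) x :=
      (hL.fderiv_right (m := 1) (by norm_num)).differentiable one_ne_zero x
    have := HasFDerivAt.comp_hasDerivAt (x := (0 : ℝ)) (f := fun t : ℝ => x + t • d)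
      (l := fderiv ℝ L) (l' := fderiv ℝ (fderiv ℝ L) x) (by simpa using hd1.hasFDerivAt) (hline 0)
    exact this.clm_apply (hasDerivAt_const _ d) |>.congr_deriv (by simp)
  have hT := second_symmetric_difference hg hg1 hg2
  -- the quartic term
  have hquart : ∀ t : ℝ, ‖x + t • d - xbar‖ ^ 4 + ‖x + (-t) • d - xbar‖ ^ 4 -
      2 * ‖x - xbar‖ ^ 4 ≤ 4 * (t ^ 2 * (3 * ‖x - xbar‖ ^ 2 * ‖d‖ ^ 2)) +
        4 * (t ^ 4 * (‖d‖ ^ 4 / 2)) := by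
    intro t
    have hsq : ∀ s : ℝ, ‖x + s • d - xbar‖ ^ 2 =
        ‖x - xbar‖ ^ 2 + 2 * (s * inner ℝ (x - xbar) d) + s ^ 2 * ‖d‖ ^ 2 := by
      intro s
      rw [show x + s • d - xbar = (x - xbar) + s • d by abel, norm_add_sq_real, inner_smul_right,
        norm_smul, mul_pow, Real.norm_eq_abs, sq_abs]
    -- With `a = ‖x - xbar‖ ^ 2`, `e = ‖d‖ ^ 2` and `s` the inner product, the left side of `hquart`
    -- is `4 t ^ 2 a e + 8 t ^ 2 s ^ 2 + 2 t ^ 4 e ^ 2`. Cauchy-Schwarz bounds `s ^ 2` by `a e`,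
    -- which gives the constant `12 = 4 * 3`.
    have hcs : (inner ℝ (x - xbar) d) ^ 2 ≤ ‖x - xbar‖ ^ 2 * ‖d‖ ^ 2 := by
      rw [← mul_pow]
      exact sq_le_sq' (neg_le_of_abs_le (abs_real_inner_le_norm _ _)) (real_inner_le_norm _ _)
    have h4 : ∀ s : ℝ, ‖x + s • d - xbar‖ ^ 4 = (‖x + s • d - xbar‖ ^ 2) ^ 2 := fun s => by ring
    rw [h4, h4, hsq, hsq]
    have := mul_le_mul_of_nonneg_left hcs (sq_nonneg t)
    nlinarith
  -- conclusion
  let R : ℝ → ℝ := fun t => (L (x + t • d) + L (x + (-t) • d) - 2 * L (x + (0 : ℝ) • d) -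
      t ^ 2 * fderiv ℝ (fderiv ℝ L) x d d) + t ^ 4 * (‖d‖ ^ 4 / 2) +
      (r / 2 * r1 t + r / 2 * r1 (-t) + (r / 2 * r2 t + r / 2 * r2 (-t)))
  have hR : R =o[𝓝 0] fun t => t ^ 2 :=
    (hT.add hr4).add (((hr1.const_mul_left _).add ((hflip hr1).const_mul_left _)).add
      ((hr2.const_mul_left _).add ((hflip hr2).const_mul_left _)))
  refine nonneg_of_eventually_nonneg_add_isLittleO (r := R) ?_ hR
  -- The joint inequality is used at `t` and at `-t`; the sum contains the acceleration term twice,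
  -- hence the factor 2 of the sigma-term.
  filter_upwards [hlinec.eventually H, (hlinec.comp hn).eventually H] with t ht1 ht2
  have a1 := ht1 (Z t) (hZpos t)
  have a2 := ht2 (Z (-t)) (hZpos (-t))
  have a3 := hquart t
  have hin : ∀ s, matInner Ω (Z s - Z₀) = s ^ 2 * matInner Ω (Bᵀ * Z₀ * B) := by
    intro s
    rw [hZ, matInner_add_right, matInner_smul_right, matInner_smul_right, hΩ, mul_zero, zero_add]
  rw [hin] at a1 a2
  simp only [Function.comp] at a2
  simp only [R, r1, r2, hline0]
  linarith

end SecondOrder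

/-! ### The external penalty method and compactness of the orthogonal group. -/

section Penalty

/-- The external penalty method with a quartic proximal term. -/
theorem exists_penalty_seq {E : Type*} [NormedAddCommGroup E] [ProperSpace E] {f P : E → ℝ}
    (hf : Continuous f) (hP : Continuous P) (hP0 : ∀ y, 0 ≤ P y) {xbar : E} (hPx : P xbar = 0)
    (hmin : ∀ᶠ y in 𝓝 xbar, P y = 0 → f xbar ≤ f y) :
    ∃ x : ℕ → E, Tendsto x atTop (𝓝 xbar) ∧
      Tendsto (fun k : ℕ => ((k : ℝ) + 1) * P (x k)) atTop (𝓝 0) ∧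
      ∀ᶠ k : ℕ in atTop, IsLocalMin
        (fun y => f y + ‖y - xbar‖ ^ 4 / 4 + ((k : ℝ) + 1) / 2 * P y) (x k) := by
  obtain ⟨δ, hδ, hball⟩ := Metric.nhds_basis_closedBall.eventually_iff.mp hmin
  have hcomp : IsCompact (Metric.closedBall xbar δ) := isCompact_closedBall _ _
  have hmem : xbar ∈ Metric.closedBall xbar δ := Metric.mem_closedBall_self hδ.le
  have hex : ∀ k : ℕ, ∃ x ∈ Metric.closedBall xbar δ, IsMinOn
      (fun y => f y + ‖y - xbar‖ ^ 4 / 4 + ((k : ℝ) + 1) / 2 * P y)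
      (Metric.closedBall xbar δ) x := fun k =>
    hcomp.exists_isMinOn ⟨_, hmem⟩ (by fun_prop)
  choose x hx hxmin using hex
  have hle : ∀ k : ℕ, f (x k) + ‖x k - xbar‖ ^ 4 / 4 + ((k : ℝ) + 1) / 2 * P (x k) ≤ f xbar := by
    intro k
    have := isMinOn_iff.mp (hxmin k) xbar hmem
    simpa [hPx] using this
  -- A lower bound of `f` on the ball turns `hle` into `P (x k) = O(1 / (k + 1))`.
  obtain ⟨z, -, hz⟩ := hcomp.exists_isMinOn ⟨_, hmem⟩ hf.continuousOn
  have hPk : ∀ k : ℕ, P (x k) ≤ 2 * (f xbar - f z) * (1 / ((k : ℝ) + 1)) := by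
    intro k
    have h1 := hle k
    have h2 : f z ≤ f (x k) := isMinOn_iff.mp hz (x k) (hx k)
    have h3 : 0 ≤ ‖x k - xbar‖ ^ 4 := by positivity
    have h4 : (0 : ℝ) < (k : ℝ) + 1 := by positivity
    rw [mul_one_div, le_div_iff₀ h4]
    linarith
  have hPlim : Tendsto (fun k => P (x k)) atTop (𝓝 0) := by
    refine squeeze_zero (fun k => hP0 _) hPk ?_
    simpa using (tendsto_one_div_add_atTop_nhds_zero_nat (𝕜 := ℝ)).const_mul (2 * (f xbar - f z))
  have hlim : Tendsto x atTop (𝓝 xbar) := by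
    -- A cluster point `y` satisfies `P y = 0` and `f y + ‖y - xbar‖ ^ 4 / 4 ≤ f xbar ≤ f y`, which
    -- forces `y = xbar`. The proximal term is what makes the cluster point unique.
    refine hcomp.tendsto_nhds_of_unique_mapClusterPt (Eventually.of_forall hx) fun y hy hyc => ?_
    obtain ⟨ψ, hψ, hψlim⟩ := hyc.tendsto_subseq
    have h1 : P y = 0 := tendsto_nhds_unique ((hP.tendsto y).comp hψlim)
      (hPlim.comp hψ.tendsto_atTop)
    have h2 : f y + ‖y - xbar‖ ^ 4 / 4 ≤ f xbar := by
      have hc : Continuous fun y => f y + ‖y - xbar‖ ^ 4 / 4 := by fun_prop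
      refine le_of_tendsto ((hc.tendsto y).comp hψlim) (Eventually.of_forall fun k => ?_)
      have h3 := hle (ψ k)
      have h4 : 0 ≤ (((ψ k : ℕ) : ℝ) + 1) / 2 * P (x (ψ k)) :=
        mul_nonneg (by positivity) (hP0 _)
      simp only [Function.comp]
      linarith
    have h3 := hball hy h1
    have h4 : ‖y - xbar‖ ^ 4 = 0 := le_antisymm (by linarith) (by positivity)
    exact sub_eq_zero.mp (norm_eq_zero.mp (pow_eq_zero_iff (by norm_num) |>.mp h4))
  refine ⟨x, hlim, ?_, ?_⟩
  -- Once `x k → xbar` is known, `hle` bounds the scaled penalty by `2 (f xbar - f (x k))`, sharper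
  -- than the boundedness obtained from `hPk`.
  · have h1 : Tendsto (fun k => 2 * (f xbar - f (x k))) atTop (𝓝 0) := by
      have := (((hf.tendsto xbar).comp hlim).const_sub (f xbar)).const_mul 2
      simpa using this
    refine squeeze_zero (fun k => mul_nonneg (by positivity) (hP0 _)) (fun k => ?_) h1
    have h2 := hle k
    have h3 : 0 ≤ ‖x k - xbar‖ ^ 4 := by positivity
    linarith
  -- Eventually `x k` is interior to the ball, so the constrained minimum is an unconstrained local
  -- one.
  · filter_upwards [hlim.eventually (Metric.ball_mem_nhds xbar hδ)] with k hk
    exact (hxmin k).isLocalMin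
      (mem_of_superset (Metric.isOpen_ball.mem_nhds hk) Metric.ball_subset_closedBall)

theorem isCompact_orthogonalGroup (m : ℕ) :
    IsCompact {V : Matrix (Fin m) (Fin m) ℝ | V ∈ Matrix.orthogonalGroup (Fin m) ℝ} := by
  refine Metric.isCompact_of_isClosed_isBounded ?_ ?_
  · have : {V : Matrix (Fin m) (Fin m) ℝ | V ∈ Matrix.orthogonalGroup (Fin m) ℝ} =
        {V | V * Vᵀ = 1} := by
      ext V
      exact Matrix.mem_orthogonalGroup_iff (Fin m) ℝ
    rw [this]
    exact isClosed_eq (by fun_prop) continuous_const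
  · refine (Metric.isBounded_closedBall (x := 0) (r := Real.sqrt m)).subset fun V hV => ?_
    rw [mem_closedBall_zero_iff]
    refine Real.le_sqrt_of_sq_le ?_
    rw [frobenius_norm_sq, matInner, (Matrix.mem_orthogonalGroup_iff' (Fin m) ℝ).mp hV]
    simp

end Penalty

/-! ### Derivatives of the data, the joint inequality, and a uniform spectral gap. -/

section Derivatives

variable {n p m : ℕ}

/-- `A ↦ ⟨A, B⟩` as a continuous linear map. -/
def matInnerCLM (B : Matrix (Fin m) (Fin m) ℝ) : Matrix (Fin m) (Fin m) ℝ →L[ℝ] ℝ :=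
  LinearMap.toContinuousLinearMap
    { toFun := fun A => matInner A B
      map_add' := fun A C => matInner_add_left A C B
      map_smul' := fun r A => matInner_smul_left r A B }

theorem contDiff_lagrangian {f : EuclideanSpace ℝ (Fin n) → ℝ}
    {h : EuclideanSpace ℝ (Fin n) → EuclideanSpace ℝ (Fin p)}
    {G : EuclideanSpace ℝ (Fin n) → Matrix (Fin m) (Fin m) ℝ} {s : WithTop ℕ∞}
    (hf : ContDiff ℝ s f) (hh : ContDiff ℝ s h) (hG : ContDiff ℝ s G)
    (μ : EuclideanSpace ℝ (Fin p)) (Ω : Matrix (Fin m) (Fin m) ℝ) :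
    ContDiff ℝ s fun y => lagrangian f h G y μ Ω :=
  (hf.sub (hh.inner ℝ contDiff_const)).sub ((matInnerCLM Ω).contDiff.comp hG)

/-- Transposition is linear and fixes `G`, hence it fixes the derivative. -/
theorem isSymm_fderiv {E : Type*} [NormedAddCommGroup E] [NormedSpace ℝ E]
    {G : E → Matrix (Fin m) (Fin m) ℝ} (hG : ∀ x, (G x).IsSymm) {x : E}
    (hd : DifferentiableAt ℝ G x) (d : E) : (fderiv ℝ G x d).IsSymm := by
  let T : Matrix (Fin m) (Fin m) ℝ →L[ℝ] Matrix (Fin m) (Fin m) ℝ :=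
    (Matrix.transposeLinearEquiv (Fin m) (Fin m) ℝ ℝ).toLinearMap.toContinuousLinearMap
  have h1 : HasFDerivAt (fun y => T (G y)) (T.comp (fderiv ℝ G x)) x :=
    T.hasFDerivAt.comp x hd.hasFDerivAt
  have h2 : (fun y => T (G y)) = G := funext fun y => hG y
  rw [h2] at h1
  have h3 := h1.unique hd.hasFDerivAt
  exact congrArg (fun S : E →L[ℝ] Matrix (Fin m) (Fin m) ℝ => S d) h3

theorem eq_sum_single (d : EuclideanSpace ℝ (Fin n)) :
    d = ∑ i, d.ofLp i • EuclideanSpace.single i (1 : ℝ) := by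
  ext j
  simp [Finset.sum_apply, Pi.single_apply]

theorem hessian_quadForm {φ : EuclideanSpace ℝ (Fin n) → ℝ} (hφ : ContDiff ℝ 2 φ)
    (x d : EuclideanSpace ℝ (Fin n)) :
    d.ofLp ⬝ᵥ (hessian φ x *ᵥ d.ofLp) = fderiv ℝ (fderiv ℝ φ) x d d := by
  have hd : DifferentiableAt ℝ (fderiv ℝ φ) x :=
    (hφ.fderiv_right (m := 1) (by norm_num)).differentiable one_ne_zero x
  have he : ∀ i j, hessian φ x i j = fderiv ℝ (fderiv ℝ φ) x (EuclideanSpace.single i 1)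
      (EuclideanSpace.single j 1) := by
    intro i j
    have h1 : HasFDerivAt (fun y => fderiv ℝ φ y (EuclideanSpace.single j 1))
        ((fderiv ℝ (fderiv ℝ φ) x).flip (EuclideanSpace.single j 1)) x := by
      refine (hd.hasFDerivAt.clm_apply (hasFDerivAt_const _ x)).congr_fderiv ?_
      simp
    exact congrArg (fun S : EuclideanSpace ℝ (Fin n) →L[ℝ] ℝ => S (EuclideanSpace.single i 1))
      h1.fderiv
  conv_rhs => rw [eq_sum_single d]
  simp only [map_sum, map_smul, sum_apply, smul_apply, smul_eq_mul,
    dotProduct, Matrix.mulVec, he, Finset.mul_sum]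
  rw [Finset.sum_comm]
  refine Finset.sum_congr rfl fun i _ => Finset.sum_congr rfl fun j _ => ?_
  ring

theorem sigmaTerm_quadForm (G : EuclideanSpace ℝ (Fin n) → Matrix (Fin m) (Fin m) ℝ)
    (x d : EuclideanSpace ℝ (Fin n)) (Ω : Matrix (Fin m) (Fin m) ℝ) :
    d.ofLp ⬝ᵥ (sigmaTerm G x Ω *ᵥ d.ofLp) =
      2 * matInner Ω (fderiv ℝ G x d * pinv (G x) * fderiv ℝ G x d) := by
  have hs : fderiv ℝ G x d = ∑ i, d.ofLp i • pderiv G i x := by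
    conv_lhs => rw [eq_sum_single d]
    simp only [map_sum, map_smul, pderiv]
    rfl
  have hsum : ∀ (B : Fin n → Matrix (Fin m) (Fin m) ℝ),
      matInner Ω (∑ i, B i) = ∑ i, matInner Ω (B i) := by
    intro B
    simp only [matInner, Matrix.mul_sum, Matrix.trace_sum]
  rw [hs]
  simp only [Matrix.sum_mul, hsum, Matrix.smul_mul, Matrix.mul_smul,
    matInner_smul_right, dotProduct, Matrix.mulVec, sigmaTerm, Matrix.of_apply, Finset.mul_sum]
  rw [Finset.sum_comm]
  refine Finset.sum_congr rfl fun i _ => Finset.sum_congr rfl fun j _ => ?_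
  ring

/-- At a local minimizer of the penalized objective, the Lagrangian with the penalty multipliers
satisfies a joint inequality in the variable and in the slack matrix. -/
theorem penalized_inequality {f : EuclideanSpace ℝ (Fin n) → ℝ}
    {h : EuclideanSpace ℝ (Fin n) → EuclideanSpace ℝ (Fin p)}
    {G : EuclideanSpace ℝ (Fin n) → Matrix (Fin m) (Fin m) ℝ} (hGsymm : ∀ x, (G x).IsSymm)
    {x xbar : EuclideanSpace ℝ (Fin n)} {r : ℝ} (hr : 0 ≤ r)
    (hmin : IsLocalMin (fun y => f y + ‖y - xbar‖ ^ 4 / 4 +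
      r / 2 * (‖h y‖ ^ 2 + Metric.infDist (G y) {Z | Z.PosSemidef} ^ 2)) x) :
    ∀ᶠ y in 𝓝 x, ∀ Z : Matrix (Fin m) (Fin m) ℝ, Z.PosSemidef →
      0 ≤ lagrangian f h G y (-(r • h x)) (r • matNeg (G x)) -
        lagrangian f h G x (-(r • h x)) (r • matNeg (G x)) +
        (‖y - xbar‖ ^ 4 - ‖x - xbar‖ ^ 4) / 4 +
        matInner (r • matNeg (G x)) (Z - matPos (G x)) + r / 2 * ‖h y - h x‖ ^ 2 +
        r / 2 * ‖G y - G x - (Z - matPos (G x))‖ ^ 2 := by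
  filter_upwards [hmin] with y hy Z hZ
  rw [infDist_posSemidef (hGsymm x)] at hy
  -- The smooth majorant: any positive semidefinite `Z` bounds the distance, with equality at `y =
  -- x`, `Z = matPos (G x)`.
  have h1 : Metric.infDist (G y) {Z | Z.PosSemidef} ^ 2 ≤ ‖G y - Z‖ ^ 2 := by
    refine pow_le_pow_left₀ Metric.infDist_nonneg ?_ 2
    rw [← dist_eq_norm]
    exact Metric.infDist_le_dist_of_mem hZ
  have h2 := mul_le_mul_of_nonneg_left h1 (show 0 ≤ r / 2 by linarith)
  have h3 : ‖h y - h x‖ ^ 2 = ‖h y‖ ^ 2 - 2 * inner ℝ (h y) (h x) + ‖h x‖ ^ 2 :=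
    norm_sub_sq_real _ _
  have h4 : ‖G y - Z‖ ^ 2 = ‖G y - G x - (Z - matPos (G x))‖ ^ 2 -
      2 * matInner (matNeg (G x)) (G y - G x - (Z - matPos (G x))) + ‖matNeg (G x)‖ ^ 2 := by
    have : G y - Z = (G y - G x - (Z - matPos (G x))) - matNeg (G x) := by
      have h0 : G x = matPos (G x) - matNeg (G x) := (matPos_sub_matNeg (hGsymm x)).symm
      generalize matPos (G x) = A, matNeg (G x) = B at h0 ⊢
      rw [h0]
      abel
    rw [this, frobenius_norm_sq, frobenius_norm_sq, frobenius_norm_sq]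
    generalize G y - G x - (Z - matPos (G x)) = C
    rw [matInner_sub_left, matInner_sub_right, matInner_sub_right, matInner_comm C (matNeg (G x))]
    ring
  have h5 : inner ℝ (h x) (h x) = ‖h x‖ ^ 2 := real_inner_self_eq_norm_sq _
  simp only [lagrangian, inner_neg_right, inner_smul_right, matInner_smul_left,
    matInner_smul_right]
  rw [matInner_sub_right, matInner_sub_right] at h4
  rw [h5, matInner_comm (G y), matInner_comm (G x)]
  nlinarith

/-- Near a positive semidefinite matrix `M`, a symmetric `N` is uniformly positive definite modulo
the span of its kernel frame. -/
theorem KernelFrame.eventually_lower_bound {b : ℕ} {M : Matrix (Fin m) (Fin m) ℝ}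
    (hM : M.PosSemidef) (U : KernelFrame M b) :
    ∃ c > 0, ∀ᶠ N in 𝓝[{N | N.IsSymm}] M, N ∈ U.nhd ∧ ∀ v : Fin m → ℝ,
      c * (v ⬝ᵥ v) ≤ v ⬝ᵥ ((N + U.toFun N * (U.toFun N)ᵀ) *ᵥ v) := by
  set W := U.toFun M with hW
  have h1 : Wᵀ * W = 1 := U.orthonormal
  have hker : Submodule.span ℝ (Set.range W.col) = LinearMap.ker M.mulVecLin := U.span_eq_ker
  -- `M + W * Wᵀ` is positive definite: a null vector lies in `ker M`, which the columns of `W`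
  -- span, and is orthogonal to those columns.
  obtain ⟨c, hc, hcb⟩ : ∃ c > 0, ∀ v : Fin m → ℝ,
      c * (v ⬝ᵥ v) ≤ v ⬝ᵥ ((M + W * Wᵀ) *ᵥ v) := by
    apply exists_quadForm_lower
    · rw [Matrix.IsSymm, Matrix.transpose_add, Matrix.transpose_mul, Matrix.transpose_transpose,
        hM.isSymm.eq]
    · intro v hv
      have hMv : 0 ≤ v ⬝ᵥ (M *ᵥ v) := by simpa using hM.dotProduct_mulVec_nonneg v
      have hsq : v ⬝ᵥ ((W * Wᵀ) *ᵥ v) = (Wᵀ *ᵥ v) ⬝ᵥ (Wᵀ *ᵥ v) := by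
        rw [← Matrix.mulVec_mulVec, Matrix.dotProduct_mulVec, Matrix.mulVec_transpose]
      have hsq0 : 0 ≤ (Wᵀ *ᵥ v) ⬝ᵥ (Wᵀ *ᵥ v) :=
        Finset.sum_nonneg fun i _ => mul_self_nonneg _
      rw [Matrix.add_mulVec, dotProduct_add, hsq]
      refine lt_of_le_of_ne (add_nonneg hMv hsq0) fun he => hv ?_
      have z1 : v ⬝ᵥ (M *ᵥ v) = 0 := by linarith
      have z2 : Wᵀ *ᵥ v = 0 := dotProduct_self_eq_zero.mp (by linarith)
      have z3 : M *ᵥ v = 0 := (hM.dotProduct_mulVec_zero_iff v).mp (by simpa using z1)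
      have hvk : v ∈ LinearMap.ker M.mulVecLin := z3
      rw [← hker, ← Matrix.range_mulVecLin] at hvk
      obtain ⟨y, rfl⟩ := hvk
      rw [Matrix.mulVecLin_apply, Matrix.mulVec_mulVec, h1, Matrix.one_mulVec] at z2
      rw [z2, map_zero]
  -- Analyticity is given only on symmetric matrices, so continuity and all limits are taken within
  -- them.
  have hcont : ContinuousWithinAt U.toFun {N | N.IsSymm} M := by
    have h2 : ContinuousWithinAt U.toFun (U.nhd ∩ {N | N.IsSymm}) M :=
      U.analyticOn.continuousOn M ⟨U.mem_nhd, hM.isSymm⟩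
    rw [Set.inter_comm] at h2
    exact (continuousWithinAt_inter (U.isOpen_nhd.mem_nhds U.mem_nhd)).mp h2
  have hbig : ∀ᶠ N in 𝓝[{N | N.IsSymm}] M,
      ∑ i, ∑ j, |((N + U.toFun N * (U.toFun N)ᵀ) - (M + W * Wᵀ)) i j| < c / 2 := by
    have hF : Continuous fun q : Matrix (Fin m) (Fin m) ℝ × Matrix (Fin m) (Fin b) ℝ =>
        ∑ i, ∑ j, |((q.1 + q.2 * q.2ᵀ) - (M + W * Wᵀ)) i j| := by fun_prop
    have hF2 : Tendsto (fun N => (N, U.toFun N)) (𝓝[{N | N.IsSymm}] M) (𝓝 (M, W)) :=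
      (tendsto_id.mono_left nhdsWithin_le_nhds).prodMk_nhds hcont
    refine ((hF.tendsto (M, W)).comp hF2).eventually_lt_const ?_
    simp [half_pos hc]
  -- Half of the gap absorbs the perturbation of the quadratic form.
  refine ⟨c / 2, half_pos hc, ?_⟩
  filter_upwards [hbig, nhdsWithin_le_nhds (U.isOpen_nhd.mem_nhds U.mem_nhd)] with N hN hN2
  refine ⟨hN2, fun v => ?_⟩
  have q1 := abs_quadForm_le ((N + U.toFun N * (U.toFun N)ᵀ) - (M + W * Wᵀ)) v
  rw [Matrix.sub_mulVec, dotProduct_sub] at q1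
  have q2 := hcb v
  have hv : 0 ≤ v ⬝ᵥ v := Finset.sum_nonneg fun i _ => mul_self_nonneg _
  have q3 := mul_le_mul_of_nonneg_right hN.le hv
  have q4 := (abs_le.mp q1).1
  linarith

end Derivatives

/-! ### The penalty sequence and AKKT complementarity. -/

section Sequence

variable {n p m : ℕ}

/-- The penalty sequence of a local minimizer, along which the eigenvectors of `G` converge. -/
theorem IsLocalMinimizer.exists_penalty_seq {f : EuclideanSpace ℝ (Fin n) → ℝ}
    {h : EuclideanSpace ℝ (Fin n) → EuclideanSpace ℝ (Fin p)}
    {G : EuclideanSpace ℝ (Fin n) → Matrix (Fin m) (Fin m) ℝ}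
    (hf : Continuous f) (hh : Continuous h) (hG : Continuous G) (hGsymm : ∀ x, (G x).IsSymm)
    {xbar : EuclideanSpace ℝ (Fin n)} (hmin : IsLocalMinimizer f h G xbar) :
    ∃ (x : ℕ → EuclideanSpace ℝ (Fin n)) (r : ℕ → ℝ) (V : ℕ → Matrix (Fin m) (Fin m) ℝ)
      (lam : ℕ → Fin m → ℝ) (U : Matrix (Fin m) (Fin m) ℝ),
      Tendsto x atTop (𝓝 xbar) ∧ (∀ k, 0 < r k) ∧
      Tendsto (fun k => r k * ‖matNeg (G (x k))‖ ^ 2) atTop (𝓝 0) ∧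
      (∀ᶠ k in atTop, IsLocalMin (fun y => f y + ‖y - xbar‖ ^ 4 / 4 +
        r k / 2 * (‖h y‖ ^ 2 + Metric.infDist (G y) {Z | Z.PosSemidef} ^ 2)) (x k)) ∧
      (∀ k, V k ∈ Matrix.orthogonalGroup (Fin m) ℝ) ∧
      (∀ k, G (x k) = V k * Matrix.diagonal (lam k) * (V k)ᵀ) ∧
      U ∈ Matrix.orthogonalGroup (Fin m) ℝ ∧ Tendsto V atTop (𝓝 U) := by
  obtain ⟨⟨hx1, hx2⟩, hloc⟩ := hmin
  have hcont : Continuous fun y =>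
      ‖h y‖ ^ 2 + Metric.infDist (G y) {Z : Matrix (Fin m) (Fin m) ℝ | Z.PosSemidef} ^ 2 :=
    (hh.norm.pow 2).add (((Metric.continuous_infDist_pt _).comp hG).pow 2)
  obtain ⟨x, hx, hP, hxmin⟩ := NSDP.exists_penalty_seq hf hcont (fun y => by positivity)
    (xbar := xbar) (by
      have : Metric.infDist (G xbar) {Z : Matrix (Fin m) (Fin m) ℝ | Z.PosSemidef} = 0 :=
        Metric.infDist_zero_of_mem hx2
      rw [this, hx1]; simp)
    (by
      filter_upwards [eventually_nhdsWithin_iff.mp hloc] with y hy hy0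
      have h1 := sq_nonneg ‖h y‖
      have h2 := sq_nonneg (Metric.infDist (G y) {Z : Matrix (Fin m) (Fin m) ℝ | Z.PosSemidef})
      refine hy ⟨?_, posSemidef_of_matNeg_eq_zero (hGsymm y) ?_⟩
      · exact norm_eq_zero.mp (pow_eq_zero_iff two_ne_zero |>.mp (by linarith))
      · rw [← norm_eq_zero, ← infDist_posSemidef (hGsymm y)]
        exact pow_eq_zero_iff two_ne_zero |>.mp (by linarith))
  choose V hV lam _ hdec using fun k => exists_sorted_diagonalization (hGsymm (x k))
  have : FirstCountableTopology (Matrix (Fin m) (Fin m) ℝ) :=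
    inferInstanceAs (FirstCountableTopology (Fin m → Fin m → ℝ))
  -- Individual eigenvectors of `G (x k)` need not converge; a subsequence makes them do so, as AKKT
  -- demands.
  obtain ⟨U, hU, φ, hφ, hlim⟩ := (isCompact_orthogonalGroup m).tendsto_subseq hV
  refine ⟨x ∘ φ, fun k => (φ k : ℝ) + 1, V ∘ φ, lam ∘ φ, U, hx.comp hφ.tendsto_atTop,
    fun k => by positivity, ?_, hφ.tendsto_atTop.eventually hxmin, fun k => hV _, fun k => hdec _,
    hU, hlim⟩
  refine squeeze_zero (fun k => by positivity) (fun k => ?_) (hP.comp hφ.tendsto_atTop)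
  simp only [Function.comp]
  rw [infDist_posSemidef (hGsymm _)]
  exact mul_le_mul_of_nonneg_left (le_add_of_nonneg_left (sq_nonneg _)) (by positivity)

/-- Complementarity of the scaled negative parts, in the sense of AKKT. -/
theorem akkt_complementarity {A : ℕ → Matrix (Fin m) (Fin m) ℝ} {M : Matrix (Fin m) (Fin m) ℝ}
    (hA : Tendsto A atTop (𝓝 M)) {V : ℕ → Matrix (Fin m) (Fin m) ℝ} {lam : ℕ → Fin m → ℝ}
    {U : Matrix (Fin m) (Fin m) ℝ} (hV : ∀ k, V k ∈ Matrix.orthogonalGroup (Fin m) ℝ)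
    (hdec : ∀ k, A k = V k * Matrix.diagonal (lam k) * (V k)ᵀ)
    (hU : U ∈ Matrix.orthogonalGroup (Fin m) ℝ) (hlim : Tendsto V atTop (𝓝 U)) (r : ℕ → ℝ) :
    ∃ U ∈ Matrix.orthogonalGroup (Fin m) ℝ, ∃ l : Fin m → ℝ,
    ∃ Uk : ℕ → Matrix (Fin m) (Fin m) ℝ, ∃ om : ℕ → Fin m → ℝ,
      (∀ k, Uk k ∈ Matrix.orthogonalGroup (Fin m) ℝ) ∧
      Tendsto Uk atTop (𝓝 U) ∧
      M = U * Matrix.diagonal l * Uᵀ ∧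
      (∀ k, r k • matNeg (A k) = Uk k * Matrix.diagonal (om k) * (Uk k)ᵀ) ∧
      ∀ j, 0 < l j → ∃ kj, ∀ k ≥ kj, om k j = 0 := by
  -- The diagonal matrices equal `(V k)ᵀ * A k * V k`, so they converge to `Uᵀ * M * U`, which must
  -- then be diagonal; its diagonal lists the eigenvalues of `M` in the matching order.
  have hconv : Tendsto (fun k => Matrix.diagonal (lam k)) atTop (𝓝 (Uᵀ * M * U)) := by
    have hc : Continuous fun q : Matrix (Fin m) (Fin m) ℝ × Matrix (Fin m) (Fin m) ℝ =>
        q.1ᵀ * q.2 * q.1 := by fun_prop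
    refine ((hc.tendsto (U, M)).comp (hlim.prodMk_nhds hA)).congr fun k => ?_
    simp only [Function.comp]
    rw [hdec, conj_transpose_conj_cancel (hV k)]
  have hentry : ∀ i j, Tendsto (fun k => Matrix.diagonal (lam k) i j) atTop
      (𝓝 ((Uᵀ * M * U) i j)) := fun i j =>
    ((continuous_apply_apply i j).tendsto (Uᵀ * M * U)).comp hconv
  have hdiag : Matrix.diagonal (fun i => (Uᵀ * M * U) i i) = Uᵀ * M * U := by
    ext i j
    by_cases hij : i = j
    · rw [hij, Matrix.diagonal_apply_eq]
    · have := hentry i j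
      simp only [Matrix.diagonal_apply_ne _ hij] at this
      rw [Matrix.diagonal_apply_ne _ hij]
      exact tendsto_nhds_unique tendsto_const_nhds this
  refine ⟨U, hU, fun i => (Uᵀ * M * U) i i, V,
    fun k i => r k * max (-lam k i) 0, hV, hlim, ?_, fun k => ?_, fun j hj => ?_⟩
  · rw [hdiag, conj_conj_cancel hU]
  · rw [hdec, matNeg, spectralMap_diagonalization _ (hV k), ← Matrix.smul_mul, ← Matrix.mul_smul,
      ← Matrix.diagonal_smul]
    rfl
  · have h1 := hentry j j
    simp only [Matrix.diagonal_apply_eq] at h1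
    -- A positive limit makes `lam k j` eventually positive, and then the negative part vanishes
    -- exactly, however large `r k` is.
    obtain ⟨kj, hkj⟩ := eventually_atTop.mp (h1.eventually_const_lt hj)
    refine ⟨kj, fun k hk => ?_⟩
    have := hkj k hk
    change r k * max (-lam k j) 0 = 0
    rw [max_eq_right (by linarith), mul_zero]

end Sequence

end NSDP

end

/-! ### A single penalty sequence satisfies both conditions. -/

theorem mainTheorem1 {n p m : ℕ}
    (f : EuclideanSpace ℝ (Fin n) → ℝ)
    (h : EuclideanSpace ℝ (Fin n) → EuclideanSpace ℝ (Fin p))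
    (G : EuclideanSpace ℝ (Fin n) → Matrix (Fin m) (Fin m) ℝ)
    (hf : ContDiff ℝ 2 f) (hh : ContDiff ℝ 2 h) (hG : ContDiff ℝ 2 G)
    (hGsymm : ∀ x, (G x).IsSymm)
    (xbar : EuclideanSpace ℝ (Fin n))
    (hmin : NSDP.IsLocalMinimizer f h G xbar) :
    NSDP.IsCAKKT2 f h G xbar ∧ NSDP.IsAKKT2 f h G xbar := by
  obtain ⟨x, r, V, lam, U, hx, hr, hcompl, hxmin, hV, hdec, hU, hlim⟩ :=
    hmin.exists_penalty_seq hf.continuous hh.continuous hG.continuous hGsymm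
  have hGx : Tendsto (fun k => G (x k)) atTop (𝓝 (G xbar)) :=
    (hG.continuous.tendsto xbar).comp hx
  let μ : ℕ → EuclideanSpace ℝ (Fin p) := fun k => -(r k • h (x k))
  let Ω : ℕ → Matrix (Fin m) (Fin m) ℝ := fun k => r k • NSDP.matNeg (G (x k))
  have hineq := hxmin.mono fun k hk => NSDP.penalized_inequality hGsymm (hr k).le hk
  have hLc : ∀ k, ContDiff ℝ 2 fun y => NSDP.lagrangian f h G y (μ k) (Ω k) := fun k =>
    NSDP.contDiff_lagrangian hf hh hG _ _
  have hpsd : ∀ k, (Ω k).PosSemidef := fun k =>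
    (NSDP.posSemidef_matNeg (hGsymm (x k))).smul (hr k).le
  have hdx : Tendsto (fun k => x k - xbar) atTop (𝓝 0) := by
    simpa using hx.sub_const xbar
  have hgrad : Tendsto (fun k => gradient (fun y => NSDP.lagrangian f h G y (μ k) (Ω k)) (x k))
      atTop (𝓝 0) := by
    have h1 : Tendsto (fun k => -(‖x k - xbar‖ ^ 2 • (x k - xbar))) atTop (𝓝 0) := by
      simpa using ((hdx.norm.pow 2).smul hdx).neg
    refine h1.congr' ?_
    filter_upwards [hineq] with k hk
    exact (NSDP.gradient_eq_of_penalized ((hLc k).differentiable two_ne_zero _)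
      (hh.differentiable two_ne_zero _) (hG.differentiable two_ne_zero _)
      (NSDP.posSemidef_matPos (hGsymm (x k))) hk).symm
  have hjordan : Tendsto (fun k => NSDP.jordan (G (x k)) (Ω k)) atTop (𝓝 0) := by
    refine squeeze_zero_norm (fun k => ?_) hcompl
    rw [NSDP.jordan_matNeg (hGsymm _), norm_neg, norm_smul, Real.norm_eq_abs, abs_of_pos (hr k),
      pow_two]
    exact mul_le_mul_of_nonneg_left (Matrix.frobenius_norm_mul _ _) (hr k).le
  -- The term `3 * ‖x k - xbar‖ ^ 2` bounds the Hessian of the quartic term; `1 / (k + 1)` only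
  -- keeps the tolerance positive when `x k = xbar`. The tolerance does not depend on the frame `W`;
  -- only `nbar` does.
  have hsecond : NSDP.IsSecondOrderSeq f h G xbar x μ Ω
      fun k => 3 * ‖x k - xbar‖ ^ 2 + 1 / ((k : ℝ) + 1) := by
    refine ⟨fun k => by positivity, ?_, fun b W => ?_⟩
    · simpa using ((hdx.norm.pow 2).const_mul 3).add
        (tendsto_one_div_add_atTop_nhds_zero_nat (𝕜 := ℝ))
    obtain ⟨c, hc, hlow⟩ := W.eventually_lower_bound hmin.1.2
    have hGx' : Tendsto (fun k => G (x k)) atTop (𝓝[{N | N.IsSymm}] (G xbar)) :=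
      tendsto_nhdsWithin_iff.mpr ⟨hGx, Eventually.of_forall fun k => hGsymm _⟩
    obtain ⟨nbar, hnbar⟩ := eventually_atTop.mp ((hGx'.eventually hlow).and hineq)
    refine ⟨nbar, fun k hk => ?_⟩
    obtain ⟨⟨hmem, hpos⟩, hk⟩ := hnbar k hk
    refine ⟨hmem, fun d hd => ?_⟩
    -- The diagonalization attached to the frame need not be the convergent one `V k`; this is
    -- harmless, since the matrix parts do not depend on it.
    obtain ⟨-, Q, hQ, l, -, hQdec, hspan⟩ := W.isSmallestEigenbasis _ hmem (hGsymm _)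
    have hGd : DifferentiableAt ℝ G (x k) := hG.differentiable two_ne_zero _
    obtain ⟨B, hB1, hB2, hB3⟩ := NSDP.exists_congruence_direction_of_frame hQ hQdec hspan hc hpos
      (NSDP.isSymm_fderiv hGsymm hGd d) hd.2
    have key := NSDP.second_order_of_penalized (hLc k) (hh.differentiable two_ne_zero _) hGd
      (NSDP.posSemidef_matPos (hGsymm (x k))) hk hd.1 hB1
      (by rw [NSDP.matInner_smul_left, hB2, mul_zero])
    rw [NSDP.matInner_smul_left, hB3, ← NSDP.matInner_smul_left] at key
    rw [Matrix.add_mulVec, dotProduct_add, NSDP.hessian_quadForm (hLc k),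
      NSDP.sigmaTerm_quadForm]
    have h1 : 0 ≤ 1 / ((k : ℝ) + 1) * ‖d‖ ^ 2 := by positivity
    simp only [Ω, μ, ge_iff_le]
    linarith
  refine ⟨⟨hmin.1, x, μ, Ω, _, ⟨hpsd, hx, hgrad, hjordan⟩, hsecond⟩,
    ⟨hmin.1, x, μ, Ω, _, ⟨hpsd, hx, hgrad, ?_⟩, hsecond⟩⟩
  exact NSDP.akkt_complementarity hGx hV hdec hU hlim r
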